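/- For complex numbers put $$\Gamma\begin{bmatrix}a_1,\dots,a_k\\ b_1,\dots,b_l\end{bmatrix}:=\frac{\Gamma(a_1)\cdots\Gamma(a_k)}{\Gamma(b_1)\cdots\Gamma(b_l)},$$ and let ${}_2F_1(p,q;r;x)$ denote the Gauss hypergeometric function, continued analytically from $(-1,1)$ to real $x<1$. For $a,b>0$ the index hypergeometric transform of a function $f$ on $(0,\infty)$ is $$J_{a,b}f(s)=\frac1{\Gamma(a+b)}\int_0^\infty f(x)\,{}_2F_1(a+is,a-is;a+b;-x)\,x^{a+b-1}(1+x)^{a-b}\,dx,\qquad s\in\mathbb R.$$ Lemma 2.2. Let $a,b>0$. Let $c,d,p,q,u$ be complex numbers with $\operatorname{Re}c,\operatorname{Re}d,\operatorname{Re}p,\operatorname{Re}q>0$ and $0<\operatorname{Re}u<b$, and let $y,z>0$. For each function $f$ on the left below and every real $s$ the integral defining $J_{a,b}f(s)$ converges absolutely, and $J_{a,b}$ sends 1. $(1+x)^{-a-c}\ \longrightarrow\ \dfrac{\Gamma(c+is)\Gamma(c-is)}{\Gamma(c+a)\Gamma(c+b)}$; 2. $\dfrac{(1+x)^{b-a}}{(x+z)^{c+b}}\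 \longrightarrow\ \Gamma\begin{bmatrix}c+is,c-is\\ c+a,c+b\end{bmatrix}\,{}_2F_1(c+is,c-is;c+a;1-z)$; 3. $x^{-u-a}\ \longrightarrow\ \dfrac{\Gamma(b-u)}{\Gamma(a+u)}\cdot\dfrac{\Gamma(u+is)\Gamma(u-is)}{\Gamma(b+is)\Gamma(b-is)}$; 4. ${}_2F_1\bigl(p+b,q+b;a+b;-\tfrac xy\bigr)(1+x)^{b-a}\ \longrightarrow\ y^{b+p}\,\Gamma\begin{bmatrix}a+b\\ p+q,p+b,q+b\end{bmatrix}\Gamma\begin{bmatrix}p+is,p-is,q+is,q-is\\ a+is,a-is\end{bmatrix}\,{}_2F_1(p+is,p-is;p+q;1-y)$; 5. ${}_2F_1(p+b,q+b;a+b;-x)(1+x)^{b-a}\ \longrightarrow\ \Gamma\begin{bmatrix}a+b\\ p+q,p+b,q+b\end{bmatrix}\Gamma\begin{bmatrix}p+is,p-is,q+is,q-is\\ a+is,a-is\end{bmatrix}$; 6. ${}_2F_1(a+c,a+d;a+b+c+d;-x)\ \longrightarrow\ \dfrac{\Gamma(a+b+c+d)\,\Gamma(c+is)\Gamma(c-is)\Gamma(d+is)\Gamma(d-is)}{\Gamma(a+c)\Gamma(a+d)\Gamma(b+c)\Gamma(b+d)\Gamma(c+d)}$.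 -/

import Mathlib

noncomputable section

namespace IndexTransform

/-- The Gauss hypergeometric function `₂F₁(p, q; r; x)` at a real argument `x < 1`, for complex
parameters with `r ≠ 0, -1, -2, …`. On `(-1, 1)` it is the sum of the hypergeometric power series
(Mathlib's `₂F₁`). On `(-∞, -1]`, where the series diverges, it is the analytic continuation of
that sum along the real axis, written with Pfaff's transformation
`₂F₁(p, q; r; x) = (1 - x)^(-p) ₂F₁(p, r - q; r; x / (x - 1))`; there `x / (x - 1) ∈ [1/2, 1)`.
(Arguments `x ≥ 1` are never used.) -/
def hyp (p q r : ℂ) (x : ℝ) : ℂ :=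
  if |x| < 1 then ordinaryHypergeometric p q r (x : ℂ)
  else ((1 - x : ℝ) : ℂ) ^ (-p) * ordinaryHypergeometric p (r - q) r ((x / (x - 1) : ℝ) : ℂ)

/-- The integrand
`f(x) ₂F₁(b + is, b - is; b + c; -x) x^(b+c-1) (1+x)^(b-c)` of the index transform. -/
def integrand (b c : ℝ) (f : ℝ → ℂ) (s x : ℝ) : ℂ :=
  f x * hyp (b + Complex.I * s) (b - Complex.I * s) (b + c) (-x)
    * ((x ^ (b + c - 1) * (1 + x) ^ (b - c) : ℝ) : ℂ)

/-- The index hypergeometric transform `J_{b,c} f (s)`. -/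
def J (b c : ℝ) (f : ℝ → ℂ) (s : ℝ) : ℂ :=
  1 / Complex.Gamma (b + c) * ∫ x in Set.Ioi (0 : ℝ), integrand b c f s x

/-- `J_{b,c}` sends `f` to `g`: for every real `s` the integral defining `J_{b,c} f (s)` converges
absolutely, and `J_{b,c} f (s) = g s`. -/
def Sends (b c : ℝ) (f g : ℝ → ℂ) : Prop :=
  ∀ s : ℝ, MeasureTheory.IntegrableOn (integrand b c f s) (Set.Ioi 0) ∧ J b c f s = g s

/-- The quotient `Γ(a₁) ⋯ Γ(aₖ) / (Γ(b₁) ⋯ Γ(bₗ))`. -/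
def gammaQuot (num den : List ℂ) : ℂ :=
  (num.map Complex.Gamma).prod / (den.map Complex.Gamma).prod

end IndexTransform

end

/-!
The transforms are computed from a few integrals of `F(x) = ₂F₁(α, β; γ; -x)` over `(0, ∞)`.

By Pfaff's transformation, `F(x)` is on all of `(0, ∞)` equal to `(1 + x) ^ (-α)` times a power
series in `w = x / (1 + x) ∈ [0, 1)` (`hyp_neg`). Its coefficients are dominated by those of
`(1 - w) ^ (-δ)` for suitable `δ` (`exists_norm_hypCoeff_le`), so that after the substitution
`x = w / (1 - w)` the integral of `F` against `x ^ (l - 1) (1 + x) ^ (-σ)` can be evaluated term by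
term with beta integrals (`hasSum_integral_hyp`). In two cases the resulting `₃F₂(1)` collapses and
is summed by Gauss's theorem (`hasSum_gauss`): for `l = γ` (`integral_hyp_mul_one_add`), which is
the transform of `(1 + x) ^ (-a - c)`, and for `σ = γ - α - β` (`integral_hyp_mul_power`), which is
the transform of a power of `x`.

Expanding `(x + z) ^ (-σ)` in powers of `(1 - z) / (1 + x)` yields the generalized Stieltjes
transform of `x ^ (γ - 1) F(x)` at `z ∈ (0, 2)`; both sides are holomorphic in `Re z > 1 / 2`, hence
the formula holds for all `z > 0` (`integral_hyp_stieltjes`). This gives the transform of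
`(1 + x) ^ (b - a) / (x + z) ^ (c + b)`, and for `β = γ` Euler's integral for the hypergeometric
function over a half-line (`integral_euler`).

The transforms of hypergeometric functions are integrals of products of two such functions. One
factor, whose parameters allow it, is replaced by its Euler integral; Fubini's theorem
(`integral_mul_hyp_eq`) then leads to a Stieltjes transform of the other factor, and to one more
integral, which is again of the types above. In this way no analytic continuation in the parameters
is needed, and absolute convergence is part of the conclusion of Fubini's theorem.
-/

namespace IndexTransform

open Complex Filter Topology MeasureTheory Set

/-! ### Hypergeometric coefficients and the power series in the unit disc -/

/-- The coefficients `(A)ₙ (B)ₙ / ((C)ₙ n!)` of the Gauss hypergeometric series. -/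
noncomputable def hypCoeff (A B C : ℂ) (n : ℕ) : ℂ :=
  (ascPochhammer ℂ n).eval A * (ascPochhammer ℂ n).eval B /
    ((ascPochhammer ℂ n).eval C * (n.factorial : ℂ))

/-- The numbers `(δ)ₙ / n!` for real `δ`. They are the Taylor coefficients of `(1 - w) ^ (-δ)`, and
serve as a positive majorant for the coefficients of hypergeometric series. -/
noncomputable def majorant (δ : ℝ) (n : ℕ) : ℝ :=
  (ascPochhammer ℝ n).eval δ / (n.factorial : ℝ)

lemma hypCoeff_zero (A B C : ℂ) : hypCoeff A B C 0 = 1 := by simp [hypCoeff]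

lemma hypCoeff_succ (A B C : ℂ) (n : ℕ) :
    hypCoeff A B C (n + 1) = hypCoeff A B C n * ((A + n) * (B + n) / ((C + n) * (n + 1))) := by
  simp only [hypCoeff, ascPochhammer_succ_eval, Nat.factorial_succ]
  push_cast
  rw [div_mul_div_comm]
  ring

lemma hypCoeff_symm (A B C : ℂ) (n : ℕ) : hypCoeff A B C n = hypCoeff B A C n := by
  simp [hypCoeff, mul_comm]

lemma majorant_succ (δ : ℝ) (n : ℕ) :
    majorant δ (n + 1) = majorant δ n * ((δ + n) / (n + 1)) := by
  simp only [majorant, ascPochhammer_succ_eval, Nat.factorial_succ]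
  push_cast
  rw [div_mul_div_comm]
  ring

lemma majorant_pos {δ : ℝ} (hδ : 0 < δ) (n : ℕ) : 0 < majorant δ n := by
  unfold majorant
  have := ascPochhammer_pos n δ hδ
  positivity

lemma ascPochhammer_eval_ne_zero {r : ℂ} (hr : 0 < r.re) (n : ℕ) :
    (ascPochhammer ℂ n).eval r ≠ 0 := by
  rw [Ne, ascPochhammer_eval_eq_zero_iff]
  rintro ⟨k, -, hk⟩
  have := congrArg Complex.re hk
  simp at this
  have : (0:ℝ) ≤ k := k.cast_nonneg
  linarith

/-- `‖A + n‖` differs from `n + Re A` by an arbitrarily small amount when `n` is large. -/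
lemma eventually_norm_add_natCast_le (A : ℂ) {e : ℝ} (he : 0 < e) :
    ∀ᶠ n : ℕ in atTop, ‖A + n‖ ≤ n + A.re + e := by
  have h1 : ∀ᶠ n : ℕ in atTop, |A.re| + A.im ^ 2 / e ≤ (n : ℝ) :=
    tendsto_natCast_atTop_atTop.eventually_ge_atTop _
  filter_upwards [h1] with n hn
  have h0 : 0 ≤ (n : ℝ) + A.re := by
    have : 0 ≤ A.im ^ 2 / e := by positivity
    linarith [neg_abs_le A.re]
  rw [Complex.norm_def]
  apply Real.sqrt_le_iff.mpr
  refine ⟨by linarith, ?_⟩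
  have h2 : A.im ^ 2 ≤ e * (n + A.re) := by
    have : A.im ^ 2 / e ≤ n + A.re := by linarith [neg_abs_le A.re]
    rw [div_le_iff₀ he] at this
    linarith
  simp only [Complex.normSq_apply, add_re, natCast_re, add_im, natCast_im, add_zero]
  nlinarith [sq_nonneg e]

/-- The growth of hypergeometric coefficients: they are dominated by those of `(1 - w) ^ (-δ)` as
soon as `δ` is positive and exceeds `Re (A + B - C)`. The ratio of consecutive coefficients is
eventually smaller than that of the majorant. -/
theorem exists_norm_hypCoeff_le (A B C : ℂ) {δ : ℝ} (hδ : 0 < δ) (h : (A + B - C).re < δ) :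
    ∃ K : ℝ, 0 < K ∧ ∀ n, ‖hypCoeff A B C n‖ ≤ K * majorant δ n := by
  simp only [sub_re, add_re] at h
  set ε := (δ - (A.re + B.re - C.re)) / 4 with hε
  have hε0 : 0 < ε := by simp only [hε]; linarith
  have hlarge : ∀ᶠ n : ℕ in atTop,
      |A.re| + |B.re| + |C.re| + 1 + |(A.re + ε) * (B.re + ε) - δ * C.re| / ε ≤ (n : ℝ) :=
    tendsto_natCast_atTop_atTop.eventually_ge_atTop _
  have hratio : ∀ᶠ n : ℕ in atTop, ‖(A + n) * (B + n) / ((C + n) * (n + 1))‖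
      ≤ (δ + n) / (n + 1) := by
    filter_upwards [eventually_norm_add_natCast_le A hε0, eventually_norm_add_natCast_le B hε0,
      hlarge] with n hA hB hn
    have hdiv : 0 ≤ |(A.re + ε) * (B.re + ε) - δ * C.re| / ε := by positivity
    have hC0 : 0 < n + C.re := by
      linarith [abs_nonneg A.re, abs_nonneg B.re, neg_abs_le C.re]
    have hC : n + C.re ≤ ‖C + n‖ := by
      refine le_trans (le_of_eq ?_) (Complex.re_le_norm _)
      simp [add_comm]
    have hn1 : ‖((n : ℂ) + 1)‖ = n + 1 := by
      rw [← Nat.cast_succ, Complex.norm_natCast]; simp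
    rw [norm_div, norm_mul, norm_mul, hn1, ← div_div]
    gcongr
    rw [div_le_iff₀ (hC0.trans_le hC)]
    have hnA : 0 ≤ n + A.re + ε := (norm_nonneg _).trans hA
    calc ‖A + n‖ * ‖B + n‖ ≤ (n + A.re + ε) * (n + B.re + ε) := by gcongr
      _ ≤ (δ + n) * (n + C.re) := by
        have h1 : |(A.re + ε) * (B.re + ε) - δ * C.re| ≤ ε * n := by
          have : |(A.re + ε) * (B.re + ε) - δ * C.re| / ε ≤ n := by
            linarith [abs_nonneg A.re, abs_nonneg B.re, abs_nonneg C.re]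
          rw [div_le_iff₀ hε0] at this
          linarith
        have h2 : (δ + C.re - A.re - B.re - 2 * ε) * n = 2 * ε * n := by
          simp only [hε]; ring
        have h3 : 0 ≤ ε * n := by positivity
        nlinarith [le_abs_self ((A.re + ε) * (B.re + ε) - δ * C.re)]
      _ ≤ (δ + n) * ‖C + n‖ := by gcongr
  obtain ⟨N, hN⟩ := eventually_atTop.mp hratio
  -- the quotients of the two sequences decrease from `N` on
  have hdec : ∀ n, ‖hypCoeff A B C (N + n)‖ / majorant δ (N + n)
      ≤ ‖hypCoeff A B C N‖ / majorant δ N := by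
    intro n
    induction n with
    | zero => simp
    | succ n ih =>
      refine le_trans ?_ ih
      have hm := majorant_pos hδ (N + n)
      rw [← add_assoc, hypCoeff_succ, majorant_succ, norm_mul]
      have hd : 0 < (δ + (N + n : ℕ)) / ((N + n : ℕ) + 1) := by positivity
      rw [div_le_div_iff₀ (by positivity) hm]
      have := hN (N + n) (by omega)
      calc _ ≤ ‖hypCoeff A B C (N + n)‖ * ((δ + (N + n : ℕ)) / ((N + n : ℕ) + 1))
            * majorant δ (N + n) := by gcongr
        _ = _ := by ring
  set q : ℕ → ℝ := fun n => ‖hypCoeff A B C n‖ / majorant δ n with hq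
  have hq0 : ∀ n, 0 ≤ q n := fun n => div_nonneg (norm_nonneg _) (majorant_pos hδ n).le
  have hs0 : 0 ≤ ∑ k ∈ Finset.range (N + 1), q k := Finset.sum_nonneg fun k _ => hq0 k
  refine ⟨∑ k ∈ Finset.range (N + 1), q k + 1, by linarith, fun n => ?_⟩
  rw [← div_le_iff₀ (majorant_pos hδ n)]
  change q n ≤ _
  have hle : ∀ k < N + 1, q k ≤ ∑ k ∈ Finset.range (N + 1), q k := fun k hk =>
    Finset.single_le_sum (f := q) (fun i _ => hq0 i) (Finset.mem_range.mpr hk)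
  rcases lt_or_ge n (N + 1) with hn | hn
  · linarith [hle n hn]
  · obtain ⟨m, rfl⟩ := Nat.exists_eq_add_of_le (show N ≤ n by omega)
    linarith [hdec m, hle N (by omega)]

lemma ofReal_ascPochhammer_eval (δ : ℝ) (n : ℕ) :
    (((ascPochhammer ℝ n).eval δ : ℝ) : ℂ) = (ascPochhammer ℂ n).eval (δ : ℂ) := by
  induction n with
  | zero => simp
  | succ n ih => simp [ascPochhammer_succ_eval, ih]

lemma norm_ascPochhammer_eval_le {p : ℂ} {t : ℝ} (ht : ‖p‖ ≤ t) (n : ℕ) :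
    ‖(ascPochhammer ℂ n).eval p‖ ≤ (ascPochhammer ℝ n).eval t := by
  induction n with
  | zero => simp
  | succ n ih =>
    simp only [ascPochhammer_succ_eval, norm_mul]
    have h : ‖p + n‖ ≤ t + n := (norm_add_le _ _).trans (by simpa using ht)
    have h0 : 0 ≤ (ascPochhammer ℝ n).eval t := (norm_nonneg _).trans ih
    gcongr

lemma choose_add_sub_one_eq (a : ℂ) (n : ℕ) :
    Ring.choose (a + n - 1) n = (ascPochhammer ℂ n).eval a / (n.factorial : ℂ) := by
  rw [eq_div_iff (by exact_mod_cast n.factorial_ne_zero), ← Ring.multichoose_eq, mul_comm,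
    ← nsmul_eq_mul, Ring.factorial_nsmul_multichoose_eq_ascPochhammer,
    Polynomial.ascPochhammer_smeval_eq_eval]

/-- The binomial series of `(1 - w) ^ (-p)`. -/
theorem hasSum_one_sub_cpow (p : ℂ) {w : ℂ} (hw : ‖w‖ < 1) :
    HasSum (fun n : ℕ => (ascPochhammer ℂ n).eval p / (n.factorial : ℂ) * w ^ n)
      ((1 - w) ^ (-p)) := by
  have h := (one_div_one_sub_cpow_hasFPowerSeriesOnBall_zero p).hasSum
    (y := w) (by simpa [enorm_eq_nnnorm, ← NNReal.coe_lt_one] using hw)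
  simpa [FormalMultilinearSeries.ofScalars, choose_add_sub_one_eq, cpow_neg] using h

theorem hasSum_majorant (δ : ℝ) {w : ℝ} (hw : |w| < 1) :
    HasSum (fun n : ℕ => majorant δ n * w ^ n) ((1 - w) ^ (-δ)) := by
  have h := hasSum_one_sub_cpow (δ : ℂ) (w := (w : ℂ)) (by simpa using hw)
  have h0 : 0 ≤ 1 - w := by linarith [le_abs_self w]
  rw [← Complex.hasSum_ofReal]
  convert h using 1
  · ext n
    simp only [majorant]
    push_cast
    rw [ofReal_ascPochhammer_eval]
  · rw [← ofReal_one, ← ofReal_sub, ← ofReal_neg, ofReal_cpow h0]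

/-- If the coefficients `c n` are dominated by a majorant, then `∑ c n wⁿ` converges absolutely in
the unit disc. -/
lemma summable_norm_mul_pow {c : ℕ → ℂ} {K δ : ℝ} (hc : ∀ n, ‖c n‖ ≤ K * majorant δ n)
    {w : ℂ} (hw : ‖w‖ < 1) : Summable fun n => ‖c n * w ^ n‖ := by
  have h := (hasSum_majorant δ (w := ‖w‖) (by simpa using hw)).summable.mul_left K
  refine Summable.of_nonneg_of_le (fun n => norm_nonneg _) (fun n => ?_) h
  rw [norm_mul, norm_pow, ← mul_assoc]
  gcongr
  exact hc n

lemma summable_norm_hypCoeff_mul_pow (A B C : ℂ) {w : ℂ} (hw : ‖w‖ < 1) :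
    Summable fun n => ‖hypCoeff A B C n * w ^ n‖ := by
  obtain ⟨K, -, hK⟩ := exists_norm_hypCoeff_le A B C (δ := |(A + B - C).re| + 1) (by positivity)
    (by linarith [le_abs_self (A + B - C).re])
  exact summable_norm_mul_pow hK hw

lemma ordinaryHypergeometric_eq (A B C w : ℂ) :
    ordinaryHypergeometric A B C w = ∑' n, hypCoeff A B C n * w ^ n := by
  rw [ordinaryHypergeometric_eq_tsum]
  refine tsum_congr fun n => ?_
  rw [smul_eq_mul, hypCoeff, div_eq_mul_inv, mul_inv]
  ring

lemma hasSum_ordinaryHypergeometric (A B C : ℂ) {w : ℂ} (hw : ‖w‖ < 1) :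
    HasSum (fun n => hypCoeff A B C n * w ^ n) (ordinaryHypergeometric A B C w) := by
  rw [ordinaryHypergeometric_eq]
  exact (summable_norm_hypCoeff_mul_pow A B C hw).of_norm.hasSum

lemma ordinaryHypergeometric_symm (A B C w : ℂ) :
    ordinaryHypergeometric A B C w = ordinaryHypergeometric B A C w := by
  simp_rw [ordinaryHypergeometric_eq, hypCoeff_symm A B]

lemma ordinaryHypergeometric_zero_right (A C w : ℂ) : ordinaryHypergeometric A 0 C w = 1 := by
  rw [ordinaryHypergeometric_eq, tsum_eq_single 0]
  · simp [hypCoeff_zero]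
  · intro n hn
    simp [hypCoeff, Nat.pos_of_ne_zero hn]

lemma differentiableOn_ordinaryHypergeometric (A B C : ℂ) :
    DifferentiableOn ℂ (ordinaryHypergeometric A B C) (Metric.ball (0 : ℂ) 1) := by
  have hr : 1 ≤ (ordinaryHypergeometricSeries ℂ A B C).radius := by
    refine ENNReal.le_of_forall_nnreal_lt fun r hr => ?_
    have hr' : (r : ℝ) < 1 := by exact_mod_cast hr
    refine FormalMultilinearSeries.le_radius_of_summable_norm _ ?_
    have h := summable_norm_hypCoeff_mul_pow A B C (w := (r : ℂ)) (by simpa using hr')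
    refine Summable.of_nonneg_of_le (fun n => by positivity) (fun n => ?_) h
    have hcoeff : ordinaryHypergeometricCoefficient A B C n = hypCoeff A B C n := by
      rw [hypCoeff, ordinaryHypergeometricCoefficient, div_eq_mul_inv, mul_inv]
      ring
    rw [ordinaryHypergeometricSeries, FormalMultilinearSeries.ofScalars_norm, hcoeff, norm_mul,
      norm_pow]
    simp
  have h := (ordinaryHypergeometricSeries ℂ A B C).hasFPowerSeriesOnBall
    (lt_of_lt_of_le one_pos hr)
  have h2 := (h.mono one_pos hr).differentiableOn
  rwa [← ENNReal.ofReal_one, Metric.eball_ofReal] at h2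

/-! ### Pfaff's and Euler's transformations in the unit disc -/

lemma ascPochhammer_eval_add (p : ℂ) (i j : ℕ) :
    (ascPochhammer ℂ (i + j)).eval p
      = (ascPochhammer ℂ i).eval p * (ascPochhammer ℂ j).eval (p + i) := by
  rw [← ascPochhammer_mul]
  simp

/-- A form of the Chu–Vandermonde identity. -/
theorem sum_antidiagonal_hypCoeff (p q : ℂ) {r : ℂ} (hr : 0 < r.re) (k : ℕ) :
    ∑ ij ∈ Finset.HasAntidiagonal.antidiagonal k, hypCoeff p (r - q) r ij.1 * (-1) ^ ij.1 *
      ((ascPochhammer ℂ ij.2).eval (p + ij.1) / (ij.2.factorial : ℂ)) = hypCoeff p q r k := by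
  have hterm : ∀ ij ∈ Finset.HasAntidiagonal.antidiagonal k,
      hypCoeff p (r - q) r ij.1 * (-1) ^ ij.1 *
        ((ascPochhammer ℂ ij.2).eval (p + ij.1) / (ij.2.factorial : ℂ))
      = (ascPochhammer ℂ k).eval p / (ascPochhammer ℂ k).eval r *
        (Ring.choose (q - r) ij.1 * Ring.choose (r + k - 1) ij.2) := by
    rintro ⟨i, j⟩ hij
    obtain rfl : i + j = k := by simpa using hij
    have h1 : Ring.choose (q - r) i
        = (-1) ^ i * ((ascPochhammer ℂ i).eval (r - q) / (i.factorial : ℂ)) := by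
      rw [show q - r = -(r - q) by ring, Ring.choose_neg, choose_add_sub_one_eq]
      simp [Units.smul_def]
    have h2 : Ring.choose (r + ((i + j : ℕ) : ℂ) - 1) j
        = (ascPochhammer ℂ j).eval (r + i) / (j.factorial : ℂ) := by
      rw [← choose_add_sub_one_eq]
      push_cast
      congr 1
      ring
    have hri := ascPochhammer_eval_ne_zero hr i
    have hrj : (ascPochhammer ℂ j).eval (r + i) ≠ 0 :=
      ascPochhammer_eval_ne_zero (by simp; positivity) j
    have hi : (i.factorial : ℂ) ≠ 0 := by exact_mod_cast i.factorial_ne_zero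
    have hj : (j.factorial : ℂ) ≠ 0 := by exact_mod_cast j.factorial_ne_zero
    simp only [h1, h2, hypCoeff, ascPochhammer_eval_add]
    field_simp
  rw [Finset.sum_congr rfl hterm, ← Finset.mul_sum, ← Ring.add_choose_eq k (Commute.all _ _),
    show q - r + (r + k - 1) = q + k - 1 by ring, choose_add_sub_one_eq, hypCoeff,
    div_mul_div_comm]

/-- Pfaff's transformation near the origin, where the two series may be rearranged. -/
lemma pfaff_near_zero (p q : ℂ) {r : ℂ} (hr : 0 < r.re) {x : ℂ} (hx : ‖x‖ < 1 / 2) :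
    ordinaryHypergeometric p q r x
      = (1 - x) ^ (-p) * ordinaryHypergeometric p (r - q) r (x / (x - 1)) := by
  have hx1 : ‖x‖ < 1 := by linarith
  have hxne : 1 - x ≠ 0 := by
    intro h
    rw [← sub_eq_zero.mp h] at hx1
    simp at hx1
  have hpos : 0 < 1 - ‖x‖ := by linarith
  set f : ℕ × ℕ → ℂ := fun nj => hypCoeff p (r - q) r nj.1 * (-x) ^ nj.1 *
    ((ascPochhammer ℂ nj.2).eval (p + nj.1) / (nj.2.factorial : ℂ) * x ^ nj.2) with hf
  set g : ℕ × ℕ → ℝ := fun nj => ‖hypCoeff p (r - q) r nj.1‖ * ‖x‖ ^ nj.1 *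
    (majorant (‖p‖ + nj.1) nj.2 * ‖x‖ ^ nj.2) with hg
  have hmaj : ∀ (n j : ℕ), 0 ≤ majorant (‖p‖ + n) j := fun n j => by
    have h := norm_ascPochhammer_eval_le (p := p) (t := ‖p‖ + n) (by simp) j
    exact div_nonneg ((norm_nonneg _).trans h) (by positivity)
  have hg0 : ∀ nj, 0 ≤ g nj := fun nj => by
    have := hmaj nj.1 nj.2
    positivity
  have hgsum : ∀ n : ℕ, HasSum (fun j => g (n, j)) (‖hypCoeff p (r - q) r n‖ * ‖x‖ ^ n *
      (1 - ‖x‖) ^ (-(‖p‖ + n))) := fun n =>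
    (hasSum_majorant (‖p‖ + n) (w := ‖x‖) (by simpa using hx1)).mul_left _
  have hgs : Summable g := by
    rw [summable_prod_of_nonneg hg0]
    refine ⟨fun n => (hgsum n).summable, ?_⟩
    have hq : ‖((‖x‖ / (1 - ‖x‖) : ℝ) : ℂ)‖ < 1 := by
      rw [Complex.norm_of_nonneg (by positivity), div_lt_one hpos]
      linarith
    have h := (summable_norm_hypCoeff_mul_pow p (r - q) r hq).mul_left ((1 - ‖x‖) ^ (-‖p‖))
    refine h.congr fun n => ?_
    rw [(hgsum n).tsum_eq, norm_mul, norm_pow, Complex.norm_of_nonneg (by positivity), neg_add,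
      Real.rpow_add hpos, Real.rpow_neg hpos.le (n : ℝ), Real.rpow_natCast, div_pow]
    field_simp
  have hfs : Summable f := by
    refine Summable.of_norm_bounded hgs fun nj => ?_
    simp only [hf, hg, norm_mul, norm_pow, norm_neg, norm_div, majorant, Complex.norm_natCast]
    have h := norm_ascPochhammer_eval_le (p := p + nj.1) (t := ‖p‖ + nj.1)
      ((norm_add_le _ _).trans (by simp)) nj.2
    gcongr
  -- summing over the second index first gives the right-hand side
  have hrow : ∀ n : ℕ, HasSum (fun j => f (n, j))
      ((1 - x) ^ (-p) * (hypCoeff p (r - q) r n * (x / (x - 1)) ^ n)) := fun n => by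
    have h := (hasSum_one_sub_cpow (p + n) hx1).mul_left (hypCoeff p (r - q) r n * (-x) ^ n)
    have e : (1 - x) ^ (-p) * (hypCoeff p (r - q) r n * (x / (x - 1)) ^ n)
        = hypCoeff p (r - q) r n * (-x) ^ n * (1 - x) ^ (-(p + n)) := by
      rw [neg_add, cpow_add _ _ hxne, cpow_neg _ (n : ℂ), cpow_natCast,
        show x / (x - 1) = (-x) * (1 - x)⁻¹ by
          rw [← neg_sub 1 x, div_neg, neg_mul, div_eq_mul_inv], mul_pow, inv_pow]
      ring
    rw [e]
    exact h
  have hw : ‖x / (x - 1)‖ < 1 := by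
    rw [norm_div, ← norm_neg (x - 1), neg_sub]
    have : 1 - ‖x‖ ≤ ‖1 - x‖ := by
      have := norm_sub_norm_le 1 x
      simpa using this
    rw [div_lt_one (by linarith)]
    linarith
  have hR := hfs.hasSum.prod_fiberwise hrow
  have hR' := (hasSum_ordinaryHypergeometric p (r - q) r hw).mul_left ((1 - x) ^ (-p))
  -- summing over antidiagonals gives the left-hand side
  have hL := (Finset.HasAntidiagonal.sigmaAntidiagonalEquivProd (A := ℕ)).hasSum_iff.mpr hfs.hasSum
  have hL2 := hL.sigma (g := fun k => hypCoeff p q r k * x ^ k) fun k => by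
    convert hasSum_fintype _ using 1
    rw [← sum_antidiagonal_hypCoeff p q hr k, Finset.sum_mul, Finset.univ_eq_attach,
      ← Finset.sum_attach]
    refine Finset.sum_congr rfl fun ij _ => ?_
    obtain ⟨⟨i, j⟩, hij⟩ := ij
    obtain rfl : i + j = k := by simpa using hij
    simp only [hf, Function.comp, Finset.HasAntidiagonal.sigmaAntidiagonalEquivProd_apply,
      neg_pow x i, pow_add]
    ring
  rw [(hasSum_ordinaryHypergeometric p q r hx1).unique hL2, hR'.unique hR]

lemma norm_div_sub_one_lt_one {x : ℂ} (hx : x.re < 1 / 2) : ‖x / (x - 1)‖ < 1 := by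
  have hne : x - 1 ≠ 0 := by
    intro h
    have := congrArg Complex.re h
    simp at this
    linarith
  rw [norm_div, div_lt_one (norm_pos_iff.mpr hne), ← sq_lt_sq₀ (norm_nonneg _) (norm_nonneg _),
    ← Complex.normSq_eq_norm_sq, ← Complex.normSq_eq_norm_sq, Complex.normSq_apply,
    Complex.normSq_apply]
  simp only [sub_re, one_re, sub_im, one_im, sub_zero]
  nlinarith

/-- The right-hand side of Pfaff's transformation is holomorphic in the half-plane
`Re x < 1 / 2`. -/
lemma differentiableOn_pfaff (p q r : ℂ) :
    DifferentiableOn ℂ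
      (fun x : ℂ => (1 - x) ^ (-p) * ordinaryHypergeometric p q r (x / (x - 1)))
      {x : ℂ | x.re < 1 / 2} := by
  intro x hx
  have hx' : x.re < 1 / 2 := hx
  have hslit : 1 - x ∈ slitPlane := Or.inl (by simp; linarith)
  have hne : x - 1 ≠ 0 := by
    rw [← neg_sub, neg_ne_zero]
    exact slitPlane_ne_zero hslit
  have h1 : DifferentiableAt ℂ (fun x : ℂ => (1 - x) ^ (-p)) x :=
    (by fun_prop : DifferentiableAt ℂ (fun x : ℂ => 1 - x) x).cpow_const hslit
  have h2 : DifferentiableAt ℂ (fun x : ℂ => x / (x - 1)) x := by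
    fun_prop (disch := assumption)
  have h3 : DifferentiableAt ℂ (ordinaryHypergeometric p q r) (x / (x - 1)) :=
    (differentiableOn_ordinaryHypergeometric p q r).differentiableAt
      (Metric.isOpen_ball.mem_nhds (by simpa using norm_div_sub_one_lt_one hx'))
  exact (h1.mul (h3.comp x h2)).differentiableWithinAt

/-- **Pfaff's transformation** on the part of the unit disc where both series converge. -/
theorem pfaff (p q : ℂ) {r : ℂ} (hr : 0 < r.re) {x : ℂ} (hx : ‖x‖ < 1) (hx2 : x.re < 1 / 2) :
    ordinaryHypergeometric p q r x
      = (1 - x) ^ (-p) * ordinaryHypergeometric p (r - q) r (x / (x - 1)) := by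
  set U : Set ℂ := Metric.ball 0 1 ∩ {x : ℂ | x.re < 1 / 2} with hU
  have hopen : IsOpen U :=
    Metric.isOpen_ball.inter (isOpen_lt Complex.continuous_re continuous_const)
  have hconv : Convex ℝ U := (convex_ball _ _).inter (convex_halfSpace_re_lt _)
  refine AnalyticOnNhd.eqOn_of_preconnected_of_eventuallyEq (z₀ := 0) (U := U)
    (((differentiableOn_ordinaryHypergeometric p q r).mono inter_subset_left).analyticOnNhd hopen)
    (((differentiableOn_pfaff p (r - q) r).mono inter_subset_right).analyticOnNhd hopen)
    hconv.isPreconnected (by simp [hU]) ?_ ⟨by simpa using hx, hx2⟩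
  filter_upwards [Metric.ball_mem_nhds (0 : ℂ) (ε := 1 / 2) (by norm_num)] with y hy
  exact pfaff_near_zero p q hr (by simpa using hy)

/-- **Euler's transformation** in the unit disc: apply Pfaff's transformation twice near the
origin and continue. -/
theorem euler_transformation (p q : ℂ) {r : ℂ} (hr : 0 < r.re) {x : ℂ} (hx : ‖x‖ < 1) :
    ordinaryHypergeometric p q r x
      = (1 - x) ^ (r - p - q) * ordinaryHypergeometric (r - p) (r - q) r x := by
  have hopen : IsOpen (Metric.ball (0 : ℂ) 1) := Metric.isOpen_ball
  refine AnalyticOnNhd.eqOn_of_preconnected_of_eventuallyEq (z₀ := 0) (U := Metric.ball (0 : ℂ) 1)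
    (f := ordinaryHypergeometric p q r)
    (g := fun x => (1 - x) ^ (r - p - q) * ordinaryHypergeometric (r - p) (r - q) r x)
    ((differentiableOn_ordinaryHypergeometric p q r).analyticOnNhd hopen)
    (DifferentiableOn.analyticOnNhd (DifferentiableOn.mul (fun y hy => ?_)
      (differentiableOn_ordinaryHypergeometric _ _ r)) hopen)
    (convex_ball _ _).isPreconnected (by simp) ?_ (by simpa using hx)
  · have hy' : ‖y‖ < 1 := by simpa using hy
    have hslit : 1 - y ∈ slitPlane := Or.inl (by simp; linarith [Complex.re_le_norm y])
    exact ((by fun_prop : DifferentiableAt ℂ (fun x : ℂ => 1 - x) y).cpow_const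
      hslit).differentiableWithinAt
  · filter_upwards [Metric.ball_mem_nhds (0 : ℂ) (ε := 1 / 3) (by norm_num)] with y hy
    have hy' : ‖y‖ < 1 / 3 := by simpa using hy
    have hre : y.re < 1 / 2 := by linarith [Complex.re_le_norm y]
    have hne : 1 - y ≠ 0 := by
      intro h
      rw [← sub_eq_zero.mp h] at hy'
      norm_num at hy'
    have hne' : y - 1 ≠ 0 := by rwa [← neg_sub, neg_ne_zero]
    have hw := norm_div_sub_one_lt_one hre
    have hw2 : ‖y / (y - 1)‖ < 1 / 2 := by
      have : 1 - ‖y‖ ≤ ‖y - 1‖ := by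
        rw [norm_sub_rev]
        simpa using norm_sub_norm_le 1 y
      rw [norm_div, div_lt_iff₀ (by linarith)]
      linarith
    have hinv : 1 - y / (y - 1) = (1 - y)⁻¹ := by field_simp; ring
    have hback : y / (y - 1) / (y / (y - 1) - 1) = y := by field_simp; ring
    have harg : (1 - y).arg ≠ Real.pi :=
      (mem_slitPlane_iff_arg.mp (Or.inl (by simp; linarith : 0 < (1 - y).re))).1
    rw [pfaff p q hr (by linarith) hre, ordinaryHypergeometric_symm,
      pfaff (r - q) p hr hw (by linarith [Complex.re_le_norm (y / (y - 1))]), hback, hinv,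
      inv_cpow _ _ harg, cpow_neg _ (r - q), inv_inv, ← mul_assoc, ← cpow_add _ _ hne,
      ordinaryHypergeometric_symm (r - q)]
    congr 2
    ring

/-! ### The hypergeometric function on `(-∞, 1)` -/

lemma hyp_of_abs_lt_one (p q r : ℂ) {x : ℝ} (hx : |x| < 1) :
    hyp p q r x = ordinaryHypergeometric p q r (x : ℂ) := by
  rw [hyp, if_pos hx]

lemma hyp_zero (p q r : ℂ) : hyp p q r 0 = 1 := by
  rw [hyp_of_abs_lt_one p q r (by simp)]
  simp

lemma norm_div_one_add_lt_one {x : ℝ} (hx : 0 ≤ x) : ‖((x / (1 + x) : ℝ) : ℂ)‖ < 1 := by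
  rw [Complex.norm_of_nonneg (by positivity), div_lt_one (by positivity)]
  linarith

/-- On the whole negative half-line `hyp` is `(1 + x) ^ (-p)` times a convergent power series in
`x / (1 + x) ∈ [0, 1)`. -/
theorem hyp_neg (p q : ℂ) {r : ℂ} (hr : 0 < r.re) {x : ℝ} (hx : 0 ≤ x) :
    hyp p q r (-x) = ((1 + x : ℝ) : ℂ) ^ (-p) *
      ordinaryHypergeometric p (r - q) r ((x / (1 + x) : ℝ) : ℂ) := by
  have harg : -x / (-x - 1) = x / (1 + x) := by
    rw [← neg_div_neg_eq]
    congr 1 <;> ring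
  rcases lt_or_ge x 1 with h | h
  · have habs : |(-x)| < 1 := by rwa [abs_neg, abs_of_nonneg hx]
    rw [hyp_of_abs_lt_one _ _ _ habs, pfaff p q hr (by simpa using habs) (by simp; linarith)]
    congr 2
    · push_cast; ring
    · rw [← harg]; push_cast; ring
  · rw [hyp, if_neg (by rw [abs_neg, abs_of_nonneg hx]; linarith), harg, sub_neg_eq_add]

/-- **Pfaff's transformation** on `(-∞, 1)`, with the argument written as `1 - z`. -/
theorem hyp_one_sub_pfaff (p q : ℂ) {r : ℂ} (hr : 0 < r.re) {z : ℝ} (hz : 0 < z) :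
    hyp p q r (1 - z) = (z : ℂ) ^ (-p) * hyp p (r - q) r (1 - z⁻¹) := by
  have hzne : (z : ℂ) ≠ 0 := by exact_mod_cast hz.ne'
  have hmem : ∀ {t : ℝ}, 1 ≤ t → |1 - t⁻¹| < 1 := fun {t} ht => by
    have h0 : 0 < t⁻¹ := by positivity
    have h1 : t⁻¹ ≤ 1 := inv_le_one_of_one_le₀ ht
    rw [abs_of_nonneg (by linarith)]
    linarith
  rcases le_total 1 z with h | h
  · rw [hyp_of_abs_lt_one p (r - q) r (hmem h), show 1 - z = -(z - 1) by ring,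
      hyp_neg p q hr (by linarith), show 1 + (z - 1) = z by ring,
      show (z - 1) / z = 1 - z⁻¹ by field_simp]
  · have h' : 1 ≤ z⁻¹ := (one_le_inv₀ hz).mpr h
    have hm := hmem h'
    rw [inv_inv] at hm
    rw [hyp_of_abs_lt_one p q r hm, show 1 - z⁻¹ = -(z⁻¹ - 1) by ring,
      hyp_neg p (r - q) hr (by linarith), show 1 + (z⁻¹ - 1) = z⁻¹ by ring,
      show (z⁻¹ - 1) / z⁻¹ = 1 - z by field_simp, sub_sub_cancel, ← mul_assoc, ofReal_inv,
      inv_cpow _ _ (by rw [arg_ofReal_of_nonneg hz.le]; exact Real.pi_ne_zero.symm),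
      mul_inv_cancel₀ (by simp [cpow_eq_zero_iff, hzne]), one_mul]

/-- Symmetry in the first two parameters. Beyond the disc it is not visible in the definition of
`hyp`, and amounts to Euler's transformation of the power series in `(z - 1) / z`. -/
theorem hyp_symm (p q : ℂ) {r : ℂ} (hr : 0 < r.re) {z : ℝ} (hz : 0 < z) :
    hyp p q r (1 - z) = hyp q p r (1 - z) := by
  rcases lt_or_ge z 1 with h | h
  · have habs : |1 - z| < 1 := by rw [abs_lt]; constructor <;> linarith
    rw [hyp_of_abs_lt_one _ _ _ habs, hyp_of_abs_lt_one _ _ _ habs, ordinaryHypergeometric_symm]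
  · have hzne : (z : ℂ) ≠ 0 := by exact_mod_cast hz.ne'
    have hw : ‖(((z - 1) / z : ℝ) : ℂ)‖ < 1 := by
      have := norm_div_one_add_lt_one (x := z - 1) (by linarith)
      rwa [add_sub_cancel] at this
    rw [show 1 - z = -(z - 1) by ring, hyp_neg p q hr (by linarith), hyp_neg q p hr (by linarith),
      add_sub_cancel, euler_transformation p (r - q) hr hw, ordinaryHypergeometric_symm q,
      show (1 : ℂ) - (((z - 1) / z : ℝ) : ℂ) = (z : ℂ)⁻¹ by push_cast; field_simp; ring,
      inv_cpow _ _ (by rw [arg_ofReal_of_nonneg hz.le]; exact Real.pi_ne_zero.symm),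
      ← cpow_neg, ← mul_assoc, ← cpow_add _ _ hzne]
    congr 2 <;> ring

/-- **Euler's transformation** on `(-∞, 1)`, with the argument written as `1 - z`. -/
theorem hyp_one_sub_euler (p q : ℂ) {r : ℂ} (hr : 0 < r.re) {z : ℝ} (hz : 0 < z) :
    hyp p q r (1 - z) = (z : ℂ) ^ (r - p - q) * hyp (r - p) (r - q) r (1 - z) := by
  have hzne : (z : ℂ) ≠ 0 := by exact_mod_cast hz.ne'
  have hz' : 0 < z⁻¹ := by positivity
  rw [hyp_one_sub_pfaff p q hr hz, hyp_symm _ _ hr hz', hyp_symm (r - p) _ hr hz,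
    hyp_one_sub_pfaff (r - q) (r - p) hr hz, ← mul_assoc, ← cpow_add _ _ hzne]
  congr 2
  all_goals ring_nf

/-! ### Termwise integration and Gauss's summation -/

lemma hasSum_of_eq {f g : ℕ → ℂ} {a b : ℂ} (h : HasSum f a) (hf : ∀ n, g n = f n) (hb : b = a) :
    HasSum g b := by
  obtain rfl : g = f := funext hf
  rwa [hb]

lemma integrableOn_beta {u v : ℂ} (hu : 0 < u.re) (hv : 0 < v.re) :
    IntegrableOn (fun t : ℝ => (t : ℂ) ^ (u - 1) * (1 - (t : ℂ)) ^ (v - 1)) (Ioo 0 1) := by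
  have h := betaIntegral_convergent hu hv
  rw [intervalIntegrable_iff_integrableOn_Ioo_of_le zero_le_one] at h
  exact h

lemma integral_beta {u v : ℂ} (hu : 0 < u.re) (hv : 0 < v.re) :
    ∫ t : ℝ in Ioo 0 1, (t : ℂ) ^ (u - 1) * (1 - (t : ℂ)) ^ (v - 1)
      = Gamma u * Gamma v / Gamma (u + v) := by
  rw [Gamma_mul_Gamma_eq_betaIntegral hu hv, mul_div_cancel_left₀ _
    (Gamma_ne_zero_of_re_pos (by simp; linarith)), betaIntegral,
    intervalIntegral.integral_of_le zero_le_one, integral_Ioc_eq_integral_Ioo]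

/-- Termwise integration of a power series against a beta weight `t ^ (l - 1) (1 - t) ^ (τ - 1)`.
The majorant `(1 - t) ^ (-δ)` stays integrable because `δ < Re τ`. -/
theorem hasSum_integral_beta {c : ℕ → ℂ} {K δ : ℝ} (hc : ∀ n, ‖c n‖ ≤ K * majorant δ n)
    {l τ : ℂ} (hl : 0 < l.re) (hδ : 0 < δ) (hτ : δ < τ.re) :
    IntegrableOn (fun t : ℝ => (t : ℂ) ^ (l - 1) * (1 - (t : ℂ)) ^ (τ - 1) *
        ∑' n, c n * (t : ℂ) ^ n) (Ioo 0 1) ∧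
      HasSum (fun n : ℕ => c n * (Gamma (l + n) * Gamma τ / Gamma (l + τ + n)))
        (∫ t : ℝ in Ioo 0 1, (t : ℂ) ^ (l - 1) * (1 - (t : ℂ)) ^ (τ - 1) *
          ∑' n, c n * (t : ℂ) ^ n) := by
  set F : ℕ → ℝ → ℂ := fun n t =>
    c n * ((t : ℂ) ^ (l + n - 1) * (1 - (t : ℂ)) ^ (τ - 1)) with hF
  set bound : ℕ → ℝ → ℝ := fun n t =>
    t ^ (l.re - 1) * (1 - t) ^ (τ.re - 1) * (K * (majorant δ n * t ^ n)) with hbound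
  have hre : ∀ n : ℕ, 0 < (l + n).re := fun n => by simp; positivity
  have hτ0 : 0 < τ.re := hδ.trans hτ
  have hFi : ∀ n, IntegrableOn (F n) (Ioo 0 1) := fun n =>
    (integrableOn_beta (hre n) hτ0).const_mul _
  have hFt : ∀ n, ∀ t : ℝ, t ∈ Ioo (0 : ℝ) 1 →
      F n t = (t : ℂ) ^ (l - 1) * (1 - (t : ℂ)) ^ (τ - 1) * (c n * (t : ℂ) ^ n) := by
    intro n t ht
    have ht0 : (t : ℂ) ≠ 0 := by exact_mod_cast ht.1.ne'
    simp only [hF]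
    rw [show l + n - 1 = (l - 1) + n by ring, cpow_add _ _ ht0, cpow_natCast]
    ring
  have hsumF : ∀ t : ℝ, t ∈ Ioo (0 : ℝ) 1 → HasSum (fun n => F n t)
      ((t : ℂ) ^ (l - 1) * (1 - (t : ℂ)) ^ (τ - 1) * ∑' n, c n * (t : ℂ) ^ n) := by
    intro t ht
    simp_rw [hFt _ t ht]
    refine ((summable_norm_mul_pow hc ?_).of_norm.hasSum).mul_left _
    rw [Complex.norm_of_nonneg ht.1.le]
    exact ht.2
  have hsumb : ∀ t : ℝ, t ∈ Ioo (0 : ℝ) 1 → HasSum (fun n => bound n t)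
      (K * (t ^ (l.re - 1) * (1 - t) ^ (τ.re - δ - 1))) := by
    intro t ht
    have h := ((hasSum_majorant δ (w := t) (by rw [abs_of_pos ht.1]; exact ht.2)).mul_left
      K).mul_left (t ^ (l.re - 1) * (1 - t) ^ (τ.re - 1))
    have h1 : 0 < 1 - t := by linarith [ht.2]
    have e : K * (t ^ (l.re - 1) * (1 - t) ^ (τ.re - δ - 1))
        = t ^ (l.re - 1) * (1 - t) ^ (τ.re - 1) * (K * (1 - t) ^ (-δ)) := by
      rw [show τ.re - δ - 1 = (τ.re - 1) + -δ by ring, Real.rpow_add h1]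
      ring
    rw [e]
    exact h
  have hle : ∀ n, ∀ t : ℝ, t ∈ Ioo (0 : ℝ) 1 → ‖F n t‖ ≤ bound n t := by
    intro n t ht
    have h1 : 0 < 1 - t := by linarith [ht.2]
    have e : (1 : ℂ) - t = ((1 - t : ℝ) : ℂ) := by push_cast; ring
    rw [hFt n t ht, e, norm_mul, norm_mul, norm_mul, norm_pow, norm_cpow_eq_rpow_re_of_pos ht.1,
      norm_cpow_eq_rpow_re_of_pos h1, Complex.norm_of_nonneg ht.1.le, sub_re, sub_re, one_re]
    simp only [hbound]
    rw [← mul_assoc K]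
    have := ht.1
    gcongr
    exact hc n
  have hbi : IntegrableOn (fun t : ℝ => K * (t ^ (l.re - 1) * (1 - t) ^ (τ.re - δ - 1)))
      (Ioo 0 1) := by
    have h := (integrableOn_beta (u := (l.re : ℂ)) (v := ((τ.re - δ : ℝ) : ℂ)) (by simpa using hl)
      (by simpa using hτ)).norm
    refine Integrable.const_mul ?_ K
    refine IntegrableOn.congr_fun h (fun t ht => ?_) measurableSet_Ioo
    have h1 : 0 < 1 - t := by linarith [ht.2]
    have e : (1 : ℂ) - t = ((1 - t : ℝ) : ℂ) := by push_cast; ring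
    simp only [e]
    rw [norm_mul, norm_cpow_eq_rpow_re_of_pos ht.1, norm_cpow_eq_rpow_re_of_pos h1]
    simp
  have hae : ∀ {p : ℝ → Prop}, (∀ t ∈ Ioo (0 : ℝ) 1, p t) →
      ∀ᵐ t ∂(volume.restrict (Ioo (0 : ℝ) 1)), p t := fun h =>
    (ae_restrict_iff' measurableSet_Ioo).mpr (ae_of_all _ h)
  refine ⟨?_, ?_⟩
  · refine Integrable.mono' hbi ?_ (hae fun t ht => ?_)
    · refine aestronglyMeasurable_of_tendsto_ae atTop
        (f := fun n t => ∑ i ∈ Finset.range n, F i t) (fun n => ?_)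
        (hae fun t ht => (hsumF t ht).tendsto_sum_nat)
      exact Finset.aestronglyMeasurable_fun_sum _ fun i _ => (hFi i).aestronglyMeasurable
    · rw [← (hsumF t ht).tsum_eq]
      exact tsum_of_norm_bounded (hsumb t ht) fun n => hle n t ht
  · have h := hasSum_integral_of_dominated_convergence
      (μ := volume.restrict (Ioo (0 : ℝ) 1)) (F := F) bound
      (fun n => (hFi n).aestronglyMeasurable) (fun n => hae (hle n))
      (hae fun t ht => (hsumb t ht).summable)
      (hbi.congr (hae fun t ht => (hsumb t ht).tsum_eq.symm)) (hae hsumF)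
    refine hasSum_of_eq h (fun n => ?_) rfl
    simp only [hF]
    rw [integral_const_mul, integral_beta (hre n) hτ0, add_right_comm]

/-- **Gauss's summation** of `₂F₁(α, d; α + s; 1)`, in the range `Re α, Re s > 0` where it follows
from Euler's beta integral. -/
theorem hasSum_gauss {α s d : ℂ} (hα : 0 < α.re) (hs : 0 < s.re) (hd : d.re < s.re) :
    HasSum (fun n : ℕ => (ascPochhammer ℂ n).eval d / (n.factorial : ℂ) *
        (Gamma (α + n) / Gamma (α + s + n)))
      (Gamma α * Gamma (s - d) / (Gamma s * Gamma (α + s - d))) := by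
  obtain ⟨δ, hδ1, hδ2⟩ := exists_between (max_lt hs hd)
  have hδ0 : 0 < δ := (le_max_left _ _).trans_lt hδ1
  have hδd : d.re < δ := (le_max_right _ _).trans_lt hδ1
  have hcoef : ∀ n, hypCoeff d 1 1 n = (ascPochhammer ℂ n).eval d / (n.factorial : ℂ) := fun n => by
    have := ascPochhammer_eval_ne_zero (r := 1) (by simp) n
    rw [hypCoeff]
    field_simp
  obtain ⟨K, -, hK⟩ := exists_norm_hypCoeff_le d 1 1 hδ0 (by simpa using hδd)
  have h := (hasSum_integral_beta hK hα hδ0 hδ2).2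
  have hint : ∫ t : ℝ in Ioo 0 1, (t : ℂ) ^ (α - 1) * (1 - (t : ℂ)) ^ (s - 1) *
      ∑' n, hypCoeff d 1 1 n * (t : ℂ) ^ n = Gamma α * Gamma (s - d) / Gamma (α + s - d) := by
    rw [show α + s - d = α + (s - d) by ring, ← integral_beta hα (by simpa using hd)]
    refine setIntegral_congr_fun measurableSet_Ioo fun t ht => ?_
    have ht1 : ‖(t : ℂ)‖ < 1 := by rw [Complex.norm_of_nonneg ht.1.le]; exact ht.2
    have hne : (1 : ℂ) - t ≠ 0 := by
      rw [sub_ne_zero]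
      exact_mod_cast ht.2.ne'
    simp only [hcoef]
    rw [(hasSum_one_sub_cpow d ht1).tsum_eq, mul_assoc, ← cpow_add _ _ hne]
    congr 2
    ring
  rw [hint] at h
  have hΓ : Gamma s ≠ 0 := Gamma_ne_zero_of_re_pos hs
  refine hasSum_of_eq (h.div_const (Gamma s)) (fun n => ?_) ?_
  · rw [hcoef]
    field_simp
  · rw [mul_comm (Gamma s), div_div]

lemma image_div_one_sub : (fun w : ℝ => w / (1 - w)) '' Ioo 0 1 = Ioi 0 := by
  ext x
  constructor
  · rintro ⟨w, hw, rfl⟩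
    exact div_pos hw.1 (by linarith [hw.2])
  · intro hx
    have hx' : 0 < x := hx
    refine ⟨x / (1 + x), ⟨by positivity, ?_⟩, ?_⟩
    · rw [div_lt_one (by positivity)]; linarith
    · simp only; field_simp; ring

lemma injOn_div_one_sub : InjOn (fun w : ℝ => w / (1 - w)) (Ioo 0 1) := by
  intro v hv w hw h
  have h1 : 1 - v ≠ 0 := by linarith [hv.2]
  have h2 : 1 - w ≠ 0 := by linarith [hw.2]
  simp only at h
  rw [div_eq_div_iff h1 h2] at h
  linarith

lemma hasDerivWithinAt_div_one_sub (w : ℝ) (hw : w ∈ Ioo (0 : ℝ) 1) :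
    HasDerivWithinAt (fun w : ℝ => w / (1 - w)) (((1 - w) ^ 2)⁻¹) (Ioo 0 1) w := by
  have h1 : 1 - w ≠ 0 := by linarith [hw.2]
  have h := ((hasDerivAt_id w).div ((hasDerivAt_const w 1).sub (hasDerivAt_id w)) h1)
  refine h.hasDerivWithinAt.congr_deriv ?_
  rw [inv_eq_one_div]
  congr 1
  simp

/-- The substitution `x = w / (1 - w)`. -/
lemma integrableOn_Ioi_iff_Ioo (g : ℝ → ℂ) : IntegrableOn g (Ioi 0) ↔
    IntegrableOn (fun w : ℝ => ((1 - w) ^ 2)⁻¹ • g (w / (1 - w))) (Ioo 0 1) := by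
  rw [← image_div_one_sub, integrableOn_image_iff_integrableOn_abs_deriv_smul measurableSet_Ioo
    hasDerivWithinAt_div_one_sub injOn_div_one_sub]
  simp only [abs_inv, abs_sq]

lemma integral_Ioi_eq_Ioo (g : ℝ → ℂ) : ∫ x in Ioi 0, g x =
    ∫ w in Ioo 0 1, ((1 - w) ^ 2)⁻¹ • g (w / (1 - w)) := by
  rw [← image_div_one_sub, integral_image_eq_integral_abs_deriv_smul measurableSet_Ioo
    hasDerivWithinAt_div_one_sub injOn_div_one_sub]
  simp only [abs_inv, abs_sq]

/-- The Mellin-type integral of a hypergeometric function against `x ^ (l - 1) (1 + x) ^ (-σ)`, as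
a series of type `₃F₂(1)`. After `x = w / (1 - w)` it is a termwise beta integral. -/
theorem hasSum_integral_hyp {α β γ l σ : ℂ} (hγ : 0 < γ.re) (hl : 0 < l.re)
    (h1 : l.re < (α + σ).re) (h2 : l.re < (β + σ).re) :
    IntegrableOn (fun x : ℝ => (x : ℂ) ^ (l - 1) * ((1 + x : ℝ) : ℂ) ^ (-σ) * hyp α β γ (-x))
        (Ioi 0) ∧
      HasSum (fun n : ℕ => hypCoeff α (γ - β) γ n *
          (Gamma (l + n) * Gamma (α + σ - l) / Gamma (α + σ + n)))
        (∫ x : ℝ in Ioi 0, (x : ℂ) ^ (l - 1) * ((1 + x : ℝ) : ℂ) ^ (-σ) * hyp α β γ (-x)) := by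
  simp only [add_re] at h1 h2
  have hmax : max 0 (α.re - β.re) < (α + σ - l).re := by
    simp only [sub_re, add_re]
    exact max_lt (by linarith) (by linarith)
  obtain ⟨δ, hδ1, hδ2⟩ := exists_between hmax
  have hδ0 : 0 < δ := (le_max_left _ _).trans_lt hδ1
  have hδd : α.re - β.re < δ := (le_max_right _ _).trans_lt hδ1
  obtain ⟨K, -, hK⟩ := exists_norm_hypCoeff_le α (γ - β) γ hδ0 (by simp; linarith)
  have h := hasSum_integral_beta hK hl hδ0 hδ2
  have hcongr : EqOn (fun w : ℝ => ((1 - w) ^ 2)⁻¹ •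
      (((w / (1 - w) : ℝ) : ℂ) ^ (l - 1) * ((1 + w / (1 - w) : ℝ) : ℂ) ^ (-σ) *
        hyp α β γ (-(w / (1 - w)))))
      (fun t : ℝ => (t : ℂ) ^ (l - 1) * (1 - (t : ℂ)) ^ (α + σ - l - 1) *
        ∑' n, hypCoeff α (γ - β) γ n * (t : ℂ) ^ n) (Ioo 0 1) := by
    intro w hw
    have h1 : 0 < 1 - w := by linarith [hw.2]
    have hne : ((1 - w : ℝ) : ℂ) ≠ 0 := by exact_mod_cast h1.ne'
    have hx : 0 ≤ w / (1 - w) := (div_pos hw.1 h1).le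
    have e1 : 1 + w / (1 - w) = (1 - w)⁻¹ := by field_simp; ring
    have e2 : w / (1 - w) / (1 - w)⁻¹ = w := by field_simp
    have harg : ((1 - w : ℝ) : ℂ).arg ≠ Real.pi := by
      rw [arg_ofReal_of_nonneg h1.le]
      exact Real.pi_ne_zero.symm
    simp only
    rw [hyp_neg α β hγ hx, e1, e2, ordinaryHypergeometric_eq, real_smul, div_eq_mul_inv, ofReal_mul,
      mul_cpow_ofReal_nonneg hw.1.le (inv_nonneg.mpr h1.le), ofReal_inv, ofReal_inv,
      inv_cpow _ _ harg, inv_cpow _ _ harg, inv_cpow _ _ harg, ← cpow_neg, ← cpow_neg, ← cpow_neg,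
      show (((1 - w) ^ 2 : ℝ) : ℂ)⁻¹ = ((1 - w : ℝ) : ℂ) ^ (-2 : ℂ) by
        rw [cpow_neg, ofReal_pow]
        norm_num,
      show (1 : ℂ) - w = ((1 - w : ℝ) : ℂ) by push_cast; ring,
      show α + σ - l - 1 = (-2) + (-(l - 1)) + (- -σ) + (- -α) by ring,
      cpow_add _ _ hne, cpow_add _ _ hne, cpow_add _ _ hne]
    ring
  rw [integrableOn_Ioi_iff_Ioo, integral_Ioi_eq_Ioo]
  refine ⟨IntegrableOn.congr_fun h.1 hcongr.symm measurableSet_Ioo, ?_⟩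
  rw [setIntegral_congr_fun measurableSet_Ioo hcongr]
  refine hasSum_of_eq h.2 (fun n => ?_) rfl
  rw [add_sub_cancel]

/-! ### Mellin and Stieltjes transforms of hypergeometric functions -/

lemma Gamma_add_natCast {z : ℂ} (hz : 0 < z.re) (n : ℕ) :
    Gamma (z + n) = (ascPochhammer ℂ n).eval z * Gamma z := by
  induction n with
  | zero => simp
  | succ n ih =>
    have hne : z + n ≠ 0 := by
      intro h
      have := congrArg Complex.re h
      simp at this
      have : (0 : ℝ) ≤ n := n.cast_nonneg
      linarith
    rw [Nat.cast_succ, ← add_assoc, Gamma_add_one _ hne, ih, ascPochhammer_succ_eval]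
    ring

/-- The integral of `x ^ (γ - 1) (1 + x) ^ (-σ) ₂F₁(α, β; γ; -x)`. -/
theorem integral_hyp_mul_one_add {α β γ σ : ℂ} (hγ : 0 < γ.re) (hα : 0 < α.re) (hσ : 0 < σ.re)
    (h1 : 0 < (α - γ + σ).re) (h2 : 0 < (β - γ + σ).re) :
    IntegrableOn (fun x : ℝ => (x : ℂ) ^ (γ - 1) * ((1 + x : ℝ) : ℂ) ^ (-σ) * hyp α β γ (-x))
        (Ioi 0) ∧
      ∫ x : ℝ in Ioi 0, (x : ℂ) ^ (γ - 1) * ((1 + x : ℝ) : ℂ) ^ (-σ) * hyp α β γ (-x)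
        = Gamma γ * Gamma (α - γ + σ) * Gamma (β - γ + σ)
          / (Gamma σ * Gamma (α + β - γ + σ)) := by
  simp only [add_re, sub_re] at h1 h2
  obtain ⟨hi, hs⟩ := hasSum_integral_hyp (α := α) (β := β) (γ := γ) (l := γ) (σ := σ) hγ hγ
    (by simp; linarith) (by simp; linarith)
  refine ⟨hi, hs.unique ?_⟩
  have hg := (hasSum_gauss (α := α) (s := σ) (d := γ - β) hα hσ (by simp; linarith)).mul_left
    (Gamma γ * Gamma (α - γ + σ) / Gamma α)
  have hΓα : Gamma α ≠ 0 := Gamma_ne_zero_of_re_pos hα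
  refine hasSum_of_eq hg (fun n => ?_) ?_
  · have hn := ascPochhammer_eval_ne_zero hγ n
    rw [hypCoeff, Gamma_add_natCast hγ, Gamma_add_natCast hα,
      show α + σ - γ = α - γ + σ by ring]
    field_simp
  · rw [show σ - (γ - β) = β - γ + σ by ring, show α + σ - (γ - β) = α + β - γ + σ by ring]
    field_simp

/-- The Mellin transform of `(1 + x) ^ (α + β - γ) ₂F₁(α, β; γ; -x)`. -/
theorem integral_hyp_mul_power {α β γ l : ℂ} (hγ : 0 < γ.re) (hl : 0 < l.re)
    (hlγ : l.re < γ.re) (h1 : 0 < (γ - α - l).re) (h2 : 0 < (γ - β - l).re) :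
    IntegrableOn (fun x : ℝ => (x : ℂ) ^ (l - 1) * ((1 + x : ℝ) : ℂ) ^ (-(γ - α - β)) *
        hyp α β γ (-x)) (Ioi 0) ∧
      ∫ x : ℝ in Ioi 0, (x : ℂ) ^ (l - 1) * ((1 + x : ℝ) : ℂ) ^ (-(γ - α - β)) * hyp α β γ (-x)
        = Gamma γ * Gamma l * Gamma (γ - α - l) * Gamma (γ - β - l)
          / (Gamma (γ - α) * Gamma (γ - β) * Gamma (γ - l)) := by
  simp only [sub_re] at h1 h2
  obtain ⟨hi, hs⟩ := hasSum_integral_hyp (α := α) (β := β) (γ := γ) (l := l) (σ := γ - α - β) hγ hl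
    (by simp; linarith) (by simp; linarith)
  refine ⟨hi, hs.unique ?_⟩
  have hg := (hasSum_gauss (α := l) (s := γ - l) (d := α) hl (by simpa using hlγ)
    (by simp; linarith)).mul_left (Gamma γ * Gamma (γ - β - l) / Gamma (γ - β))
  have hβ : 0 < (γ - β).re := by simp; linarith
  have hΓ : Gamma (γ - β) ≠ 0 := Gamma_ne_zero_of_re_pos hβ
  have hΓγ : Gamma γ ≠ 0 := Gamma_ne_zero_of_re_pos hγ
  refine hasSum_of_eq hg (fun n => ?_) ?_
  · have hn := ascPochhammer_eval_ne_zero hγ n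
    have hn' := ascPochhammer_eval_ne_zero hβ n
    rw [hypCoeff, show α + (γ - α - β) = γ - β by ring, show l + (γ - l) = γ by ring,
      Gamma_add_natCast hγ, Gamma_add_natCast hβ]
    field_simp
  · rw [show γ - l - α = γ - α - l by ring, show l + (γ - l) - α = γ - α by ring]
    field_simp

/-- `(x + z) ^ (-σ)` is comparable with `(1 + x) ^ (-σ)`, uniformly for `Re z ≥ m`. -/
lemma norm_add_cpow_le {σ : ℂ} (hσ : 0 ≤ σ.re) {m : ℝ} (hm : 0 < m) (hm1 : m ≤ 1) {z : ℂ}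
    (hz : m ≤ z.re) {x : ℝ} (hx : 0 ≤ x) :
    ‖((x : ℂ) + z) ^ (-σ)‖
      ≤ Real.exp (Real.pi * |σ.im|) * m ^ (-σ.re) * (1 + x) ^ (-σ.re) := by
  have h1 : 0 < 1 + x := by linarith
  have hlow : m * (1 + x) ≤ ‖(x : ℂ) + z‖ := by
    refine le_trans ?_ (Complex.re_le_norm _)
    simp only [add_re, ofReal_re]
    nlinarith
  have h := norm_cpow_le ((x : ℂ) + z) (-σ)
  refine h.trans ?_
  rw [div_eq_mul_inv, ← Real.exp_neg, mul_comm, mul_assoc, ← Real.mul_rpow hm.le h1.le]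
  gcongr
  · have := abs_mul (arg ((x : ℂ) + z)) σ.im
    calc -(arg ((x : ℂ) + z) * (-σ).im) ≤ |arg ((x : ℂ) + z)| * |σ.im| := by
          rw [← this, neg_im]
          simpa using le_abs_self (arg ((x : ℂ) + z) * σ.im)
      _ ≤ Real.pi * |σ.im| := by
          gcongr
          exact abs_arg_le_pi _
  · rw [neg_re]
    exact Real.rpow_le_rpow_of_nonpos (by positivity) hlow (by linarith)

lemma continuousOn_add_cpow (s : ℂ) {z : ℂ} (hz : 0 < z.re) :
    ContinuousOn (fun x : ℝ => ((x : ℂ) + z) ^ s) (Ioi 0) := fun x hx =>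
  (ContinuousAt.cpow (by fun_prop) continuousAt_const
    (Or.inl (by have : 0 < x := hx; simp; linarith))).continuousWithinAt

lemma aestronglyMeasurable_of_mul_one_add_cpow {g : ℝ → ℂ} {s : ℂ}
    (hg : IntegrableOn (fun x : ℝ => g x * ((1 + x : ℝ) : ℂ) ^ s) (Ioi 0)) :
    AEStronglyMeasurable g (volume.restrict (Ioi 0)) := by
  refine (hg.aestronglyMeasurable.mul ((continuousOn_add_cpow (-s) (z := 1)
    (by simp)).aestronglyMeasurable measurableSet_Ioi)).congr
    ((ae_restrict_iff' measurableSet_Ioi).mpr (ae_of_all _ fun x hx => ?_))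
  have hx0 : 0 < x := hx
  have hne : ((1 + x : ℝ) : ℂ) ≠ 0 := by exact_mod_cast (by linarith : 1 + x ≠ 0)
  simp only [Pi.mul_apply]
  rw [show (x : ℂ) + 1 = ((1 + x : ℝ) : ℂ) by push_cast; ring, mul_assoc, ← cpow_add _ _ hne,
    add_neg_cancel, cpow_zero, mul_one]

lemma norm_mul_add_cpow_le (g : ℝ → ℂ) {σ : ℂ} (hσ : 0 ≤ σ.re) {m : ℝ} (hm : 0 < m) (hm1 : m ≤ 1)
    {z : ℂ} (hz : m ≤ z.re) {x : ℝ} (hx : 0 ≤ x) :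
    ‖g x * ((x : ℂ) + z) ^ (-σ)‖ ≤ Real.exp (Real.pi * |σ.im|) * m ^ (-σ.re) *
      ‖g x * ((1 + x : ℝ) : ℂ) ^ (-σ)‖ := by
  rw [norm_mul, norm_mul, norm_cpow_eq_rpow_re_of_pos (by linarith), neg_re]
  calc _ ≤ ‖g x‖ * (Real.exp (Real.pi * |σ.im|) * m ^ (-σ.re) * (1 + x) ^ (-σ.re)) := by
        gcongr
        exact norm_add_cpow_le hσ hm hm1 hz hx
    _ = _ := by ring

/-- A generalized Stieltjes transform converges in the right half-plane. -/
lemma integrableOn_stieltjes {g : ℝ → ℂ} {σ : ℂ} (hσ : 0 ≤ σ.re)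
    (hg : IntegrableOn (fun x : ℝ => g x * ((1 + x : ℝ) : ℂ) ^ (-σ)) (Ioi 0)) {z : ℂ}
    (hz : 0 < z.re) : IntegrableOn (fun x : ℝ => g x * ((x : ℂ) + z) ^ (-σ)) (Ioi 0) := by
  refine Integrable.mono' (hg.norm.const_mul
    (Real.exp (Real.pi * |σ.im|) * (min z.re 1) ^ (-σ.re))) ?_ ?_
  · exact (aestronglyMeasurable_of_mul_one_add_cpow hg).mul
      ((continuousOn_add_cpow _ hz).aestronglyMeasurable measurableSet_Ioi)
  · refine (ae_restrict_iff' measurableSet_Ioi).mpr (ae_of_all _ fun x hx => ?_)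
    exact norm_mul_add_cpow_le g hσ (lt_min hz one_pos) (min_le_right _ _) (min_le_left _ _)
      (le_of_lt hx)

/-- A generalized Stieltjes transform is holomorphic in the right half-plane. -/
lemma differentiableOn_stieltjes {g : ℝ → ℂ} {σ : ℂ} (hσ : 0 ≤ σ.re)
    (hg : IntegrableOn (fun x : ℝ => g x * ((1 + x : ℝ) : ℂ) ^ (-σ)) (Ioi 0)) :
    DifferentiableOn ℂ (fun z : ℂ => ∫ x : ℝ in Ioi 0, g x * ((x : ℂ) + z) ^ (-σ))
      {z : ℂ | 0 < z.re} := by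
  intro z₀ hz₀
  have hz₀' : 0 < z₀.re := hz₀
  have hgm := aestronglyMeasurable_of_mul_one_add_cpow hg
  set m := min (z₀.re / 2) 1 with hm
  have hm0 : 0 < m := lt_min (by linarith) one_pos
  have hs : {z : ℂ | z₀.re / 2 < z.re} ∈ 𝓝 z₀ :=
    (isOpen_lt continuous_const Complex.continuous_re).mem_nhds (by simp; linarith)
  set K := ‖σ‖ * (Real.exp (Real.pi * |(σ + 1).im|) * m ^ (-(σ + 1).re)) with hK
  have hK0 : 0 ≤ K := by positivity
  have hae : ∀ {p : ℝ → Prop}, (∀ x : ℝ, 0 < x → p x) →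
      ∀ᵐ x ∂(volume.restrict (Ioi (0 : ℝ))), p x := fun h =>
    (ae_restrict_iff' measurableSet_Ioi).mpr (ae_of_all _ h)
  refine (hasDerivAt_integral_of_dominated_loc_of_deriv_le
    (F := fun (z : ℂ) (x : ℝ) => g x * ((x : ℂ) + z) ^ (-σ))
    (F' := fun (z : ℂ) (x : ℝ) => g x * (-σ * ((x : ℂ) + z) ^ (-σ - 1)))
    (bound := fun x => K * ‖g x * ((1 + x : ℝ) : ℂ) ^ (-σ)‖) hs ?_
    (integrableOn_stieltjes hσ hg hz₀') ?_ ?_ (hg.norm.const_mul K)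
    ?_).2.differentiableAt.differentiableWithinAt
  · filter_upwards [hs] with z hz
    have hz' : z₀.re / 2 < z.re := hz
    exact (integrableOn_stieltjes hσ hg (by linarith)).aestronglyMeasurable
  · exact hgm.mul (((continuousOn_add_cpow _ hz₀').aestronglyMeasurable
      measurableSet_Ioi).const_mul (-σ))
  · refine hae fun x hx z hz => ?_
    have hz' : z₀.re / 2 < z.re := hz
    have h := norm_mul_add_cpow_le g (σ := σ + 1) (by simp; linarith) hm0 (min_le_right _ _)
      ((min_le_left _ _).trans hz'.le) hx.le
    have h2 : ‖g x * ((1 + x : ℝ) : ℂ) ^ (-(σ + 1))‖ ≤ ‖g x * ((1 + x : ℝ) : ℂ) ^ (-σ)‖ := by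
      rw [norm_mul, norm_mul, norm_cpow_eq_rpow_re_of_pos (by linarith),
        norm_cpow_eq_rpow_re_of_pos (by linarith)]
      exact mul_le_mul_of_nonneg_left (Real.rpow_le_rpow_of_exponent_le (by linarith) (by simp))
        (norm_nonneg _)
    calc ‖g x * (-σ * ((x : ℂ) + z) ^ (-σ - 1))‖
        = ‖σ‖ * ‖g x * ((x : ℂ) + z) ^ (-(σ + 1))‖ := by
          rw [show -(σ + 1) = -σ - 1 by ring]
          simp only [norm_mul, norm_neg]
          ring
      _ ≤ ‖σ‖ * (Real.exp (Real.pi * |(σ + 1).im|) * m ^ (-(σ + 1).re) *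
          ‖g x * ((1 + x : ℝ) : ℂ) ^ (-σ)‖) := by
          gcongr
          exact h.trans (by gcongr)
      _ = K * ‖g x * ((1 + x : ℝ) : ℂ) ^ (-σ)‖ := by rw [hK]; ring
  · refine hae fun x hx z hz => ?_
    have hz' : z₀.re / 2 < z.re := hz
    have h1 : HasDerivAt (fun z : ℂ => (x : ℂ) + z) 1 z := (hasDerivAt_id z).const_add _
    have h2 := (h1.cpow_const (c := -σ) (Or.inl (by simp; linarith))).const_mul (g x)
    simpa using h2

lemma hyp_eq_of_lt_half (p q : ℂ) {r : ℂ} (hr : 0 < r.re) {x : ℝ} (hx : x < 1 / 2) :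
    hyp p q r x = (1 - (x : ℂ)) ^ (-p) *
      ordinaryHypergeometric p (r - q) r ((x : ℂ) / ((x : ℂ) - 1)) := by
  rcases lt_or_ge |x| 1 with h | h
  · rw [hyp_of_abs_lt_one _ _ _ h, pfaff p q hr (by simpa using h) (by simpa using hx)]
  · rw [hyp, if_neg h.not_gt]
    push_cast
    rfl

/-- The expansion of `(x + z) ^ (-σ)` in powers of `(1 - z) / (1 + x)`. -/
lemma hasSum_add_cpow (σ : ℂ) {x z : ℝ} (hx : 0 < x) (hz : 0 < z) (hz2 : z < 2) :
    HasSum (fun k : ℕ => (ascPochhammer ℂ k).eval σ / (k.factorial : ℂ) *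
      ((1 - z : ℝ) : ℂ) ^ k * ((1 + x : ℝ) : ℂ) ^ (-(σ + k))) (((x : ℂ) + z) ^ (-σ)) := by
  have h0 : 0 < 1 + x := by linarith
  have hne : ((1 + x : ℝ) : ℂ) ≠ 0 := by exact_mod_cast h0.ne'
  have hlt : ‖(((1 - z) / (1 + x) : ℝ) : ℂ)‖ < 1 := by
    rw [Complex.norm_real, Real.norm_eq_abs, abs_div, abs_of_pos h0, div_lt_one h0, abs_lt]
    constructor <;> linarith
  have h := (hasSum_one_sub_cpow σ hlt).mul_left (((1 + x : ℝ) : ℂ) ^ (-σ))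
  refine hasSum_of_eq h (fun k => ?_) ?_
  · rw [neg_add, cpow_add _ _ hne, cpow_neg _ (k : ℂ), cpow_natCast, ofReal_div, div_pow,
      div_eq_mul_inv (((1 - z : ℝ) : ℂ) ^ k)]
    ring
  · have e : (x : ℂ) + z = ((1 + x : ℝ) : ℂ) * ((1 - (1 - z) / (1 + x) : ℝ) : ℂ) := by
      rw [← ofReal_mul, ← ofReal_add]
      congr 1
      field_simp
      ring
    have hnn : 0 ≤ 1 - (1 - z) / (1 + x) := by
      rw [sub_nonneg, div_le_one h0]
      linarith
    rw [e, mul_cpow_ofReal_nonneg h0.le hnn, ofReal_sub, ofReal_one]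

/-- `integral_hyp_mul_one_add` with `σ` shifted by `k`, in terms of hypergeometric coefficients. -/
lemma integral_hyp_mul_one_add_natCast {α β γ σ : ℂ} (hγ : 0 < γ.re) (hα : 0 < α.re)
    (hσ : 0 < σ.re) (h1 : 0 < (α - γ + σ).re) (h2 : 0 < (β - γ + σ).re)
    (h3 : 0 < (α + β - γ + σ).re) (k : ℕ) :
    IntegrableOn (fun x : ℝ => (x : ℂ) ^ (γ - 1) * ((1 + x : ℝ) : ℂ) ^ (-(σ + k)) *
        hyp α β γ (-x)) (Ioi 0) ∧
      (ascPochhammer ℂ k).eval σ / (k.factorial : ℂ) * ∫ x : ℝ in Ioi 0,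
        (x : ℂ) ^ (γ - 1) * ((1 + x : ℝ) : ℂ) ^ (-(σ + k)) * hyp α β γ (-x)
      = Gamma γ * Gamma (α - γ + σ) * Gamma (β - γ + σ) / (Gamma σ * Gamma (α + β - γ + σ))
        * hypCoeff (α - γ + σ) (β - γ + σ) (α + β - γ + σ) k := by
  have hk : (0 : ℝ) ≤ k := k.cast_nonneg
  have h := integral_hyp_mul_one_add (α := α) (β := β) (σ := σ + k) hγ hα
    (by rw [add_re, natCast_re]; linarith)
    (by rw [← add_assoc, add_re, natCast_re]; linarith)
    (by rw [← add_assoc, add_re, natCast_re]; linarith)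
  refine ⟨h.1, ?_⟩
  rw [h.2]
  have hn := ascPochhammer_eval_ne_zero hσ k
  rw [← add_assoc, ← add_assoc, ← add_assoc, Gamma_add_natCast h1, Gamma_add_natCast h2,
    Gamma_add_natCast h3, Gamma_add_natCast hσ, hypCoeff]
  generalize (ascPochhammer ℂ k).eval σ = s at *
  field_simp

/-- The generalized Stieltjes transform of `x ^ (γ - 1) ₂F₁(α, β; γ; -x)` at points `z ∈ (0, 2)`:
expand `(x + z) ^ (-σ)` in powers of `(1 - z) / (1 + x)`. -/
lemma integral_hyp_stieltjes_of_lt_two {α β γ σ : ℂ} (hγ : 0 < γ.re) (hα : 0 < α.re)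
    (hσ : 0 < σ.re) (h1 : 0 < (α - γ + σ).re) (h2 : 0 < (β - γ + σ).re)
    (h3 : 0 < (α + β - γ + σ).re) {z : ℝ} (hz : 0 < z) (hz2 : z < 2) :
    ∫ x : ℝ in Ioi 0, (x : ℂ) ^ (γ - 1) * hyp α β γ (-x) * ((x : ℂ) + z) ^ (-σ)
      = Gamma γ * Gamma (α - γ + σ) * Gamma (β - γ + σ) / (Gamma σ * Gamma (α + β - γ + σ))
        * hyp (α - γ + σ) (β - γ + σ) (α + β - γ + σ) (1 - z) := by
  have hz1 : |1 - z| < 1 := by rw [abs_lt]; constructor <;> linarith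
  set F : ℕ → ℝ → ℂ := fun k x => ((ascPochhammer ℂ k).eval σ / (k.factorial : ℂ) *
    ((1 - z : ℝ) : ℂ) ^ k) *
      ((x : ℂ) ^ (γ - 1) * ((1 + x : ℝ) : ℂ) ^ (-(σ + k)) * hyp α β γ (-x)) with hF
  have hbase := integral_hyp_mul_one_add hγ hα hσ h1 h2
  have hterm := integral_hyp_mul_one_add_natCast hγ hα hσ h1 h2 h3
  have hae : ∀ {p : ℝ → Prop}, (∀ x : ℝ, 0 < x → p x) →
      ∀ᵐ x ∂(volume.restrict (Ioi (0 : ℝ))), p x := fun h =>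
    (ae_restrict_iff' measurableSet_Ioi).mpr (ae_of_all _ h)
  have hmaj := hasSum_majorant ‖σ‖ (w := |1 - z|) (by rwa [abs_abs])
  have hbound : ∀ k, ∀ x : ℝ, 0 < x → ‖F k x‖ ≤ majorant ‖σ‖ k * |1 - z| ^ k *
      ‖(x : ℂ) ^ (γ - 1) * ((1 + x : ℝ) : ℂ) ^ (-σ) * hyp α β γ (-x)‖ := by
    intro k x hx
    have h0 : 0 < 1 + x := by linarith
    have hexp : (1 + x) ^ (-(σ + k)).re ≤ (1 + x) ^ (-σ).re :=
      Real.rpow_le_rpow_of_exponent_le (by linarith) (by simp)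
    have hpoch := norm_ascPochhammer_eval_le (le_refl ‖σ‖) k
    have hpoch0 := (norm_nonneg _).trans hpoch
    simp only [hF, norm_mul, norm_div, norm_pow, Complex.norm_natCast, Complex.norm_real,
      Real.norm_eq_abs, majorant, norm_cpow_eq_rpow_re_of_pos h0]
    gcongr
  have hlim : ∀ x : ℝ, 0 < x → HasSum (fun k => F k x)
      ((x : ℂ) ^ (γ - 1) * hyp α β γ (-x) * ((x : ℂ) + z) ^ (-σ)) := by
    intro x hx
    refine hasSum_of_eq ((hasSum_add_cpow σ hx hz hz2).mul_left
      ((x : ℂ) ^ (γ - 1) * hyp α β γ (-x))) (fun k => ?_) rfl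
    simp only [hF]
    ring
  have hsum := hasSum_integral_of_dominated_convergence
    (μ := volume.restrict (Ioi (0 : ℝ))) (F := F) _
    (fun k => ((hterm k).1.const_mul _).aestronglyMeasurable)
    (fun k => hae (hbound k)) (hae fun x hx => hmaj.summable.mul_right _)
    (by simp_rw [tsum_mul_right]; exact hbase.1.norm.const_mul _) (hae hlim)
  rw [hyp_of_abs_lt_one _ _ _ hz1]
  refine hsum.unique (hasSum_of_eq ((hasSum_ordinaryHypergeometric _ _ _ (w := ((1 - z : ℝ) : ℂ))
    (by simpa only [Complex.norm_real, Real.norm_eq_abs] using hz1)).mul_left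
      (Gamma γ * Gamma (α - γ + σ) * Gamma (β - γ + σ) / (Gamma σ * Gamma (α + β - γ + σ))))
    (fun k => ?_) rfl)
  simp only [hF]
  rw [integral_const_mul, mul_right_comm, (hterm k).2]
  ring

/-- The generalized Stieltjes transform of `x ^ (γ - 1) ₂F₁(α, β; γ; -x)`. Both sides are
holomorphic for `Re z > 1 / 2`, which extends the formula from `z < 2` to all `z > 0`. -/
theorem integral_hyp_stieltjes {α β γ σ : ℂ} (hγ : 0 < γ.re) (hα : 0 < α.re)
    (hσ : 0 < σ.re) (h1 : 0 < (α - γ + σ).re) (h2 : 0 < (β - γ + σ).re)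
    (h3 : 0 < (α + β - γ + σ).re) {z : ℝ} (hz : 0 < z) :
    IntegrableOn (fun x : ℝ => (x : ℂ) ^ (γ - 1) * hyp α β γ (-x) * ((x : ℂ) + z) ^ (-σ))
        (Ioi 0) ∧
      ∫ x : ℝ in Ioi 0, (x : ℂ) ^ (γ - 1) * hyp α β γ (-x) * ((x : ℂ) + z) ^ (-σ)
        = Gamma γ * Gamma (α - γ + σ) * Gamma (β - γ + σ) / (Gamma σ * Gamma (α + β - γ + σ))
          * hyp (α - γ + σ) (β - γ + σ) (α + β - γ + σ) (1 - z) := by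
  have hg : IntegrableOn (fun x : ℝ => (x : ℂ) ^ (γ - 1) * hyp α β γ (-x) *
      ((1 + x : ℝ) : ℂ) ^ (-σ)) (Ioi 0) :=
    (integral_hyp_mul_one_add hγ hα hσ h1 h2).1.congr_fun
      (fun x _ => mul_right_comm _ _ _) measurableSet_Ioi
  refine ⟨integrableOn_stieltjes hσ.le hg (by simpa using hz), ?_⟩
  rcases lt_or_ge z 2 with hz2 | hz2
  · exact integral_hyp_stieltjes_of_lt_two hγ hα hσ h1 h2 h3 hz hz2
  set const := Gamma γ * Gamma (α - γ + σ) * Gamma (β - γ + σ) /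
    (Gamma σ * Gamma (α + β - γ + σ)) with hconst
  set A := α - γ + σ
  set B := β - γ + σ
  set C := α + β - γ + σ
  set R : ℂ → ℂ := fun w => const * ((1 - (1 - w)) ^ (-A) *
    ordinaryHypergeometric A (C - B) C ((1 - w) / ((1 - w) - 1))) with hR
  have hRreal : ∀ t : ℝ, 1 / 2 < t → R t = const * hyp A B C (1 - t) := fun t ht => by
    simp only [hR]
    rw [hyp_eq_of_lt_half A B h3 (by linarith)]
    push_cast
    rfl
  have hopen : IsOpen {w : ℂ | 1 / 2 < w.re} := isOpen_lt continuous_const Complex.continuous_re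
  have hL := ((differentiableOn_stieltjes hσ.le hg).mono
    (fun w (hw : 1 / 2 < w.re) => show 0 < w.re by linarith)).analyticOnNhd hopen
  have hRd : DifferentiableOn ℂ R {w : ℂ | 1 / 2 < w.re} := by
    refine DifferentiableOn.const_mul ?_ _
    exact (differentiableOn_pfaff A (C - B) C).comp (f := fun w : ℂ => 1 - w) (by fun_prop)
      fun w (hw : 1 / 2 < w.re) => show (1 - w).re < 1 / 2 by simp; linarith
  have hfreq : ∃ᶠ w in 𝓝[≠] (1 : ℂ),
      ∫ x : ℝ in Ioi 0, (x : ℂ) ^ (γ - 1) * hyp α β γ (-x) * ((x : ℂ) + w) ^ (-σ) = R w := by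
    have htend : Tendsto (fun t : ℝ => (t : ℂ)) (𝓝[≠] 1) (𝓝[≠] ((1 : ℝ) : ℂ)) :=
      continuous_ofReal.continuousWithinAt.tendsto_nhdsWithin
        fun t ht => by simpa using ht
    rw [ofReal_one] at htend
    refine htend.frequently (Eventually.frequently ?_)
    filter_upwards [nhdsWithin_le_nhds (Ioo_mem_nhds (show (1 / 2 : ℝ) < 1 by norm_num)
      (show (1 : ℝ) < 2 by norm_num))] with t ht
    rw [integral_hyp_stieltjes_of_lt_two hγ hα hσ h1 h2 h3 (by linarith [ht.1]) ht.2,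
      hRreal t ht.1]
  have h := hL.eqOn_of_preconnected_of_frequently_eq (hRd.analyticOnNhd hopen)
    (convex_halfSpace_re_gt _).isPreconnected (show (1 : ℂ) ∈ {w : ℂ | 1 / 2 < w.re} by
      simp; norm_num) hfreq (show (z : ℂ) ∈ {w : ℂ | 1 / 2 < w.re} by simp; linarith)
  rw [← hRreal z (by linarith)]
  exact h

/-- An Euler integral for the hypergeometric function, over the half-line. -/
theorem integral_euler {α γ σ : ℂ} (hγ : 0 < γ.re) (hα : 0 < α.re) (hσ : 0 < σ.re)
    (h1 : 0 < (α - γ + σ).re) {z : ℝ} (hz : 0 < z) :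
    ∫ v : ℝ in Ioi 0, (v : ℂ) ^ (γ - 1) * ((1 + v : ℝ) : ℂ) ^ (-α) * ((v : ℂ) + z) ^ (-σ)
      = Gamma γ * Gamma (α - γ + σ) / Gamma (α + σ) * hyp (α - γ + σ) σ (α + σ) (1 - z) := by
  have h := (integral_hyp_stieltjes (β := γ) hγ hα hσ h1 (by simpa using hσ)
    (by simp; linarith) hz).2
  rw [show γ - γ + σ = σ by ring, show α + γ - γ + σ = α + σ by ring] at h
  have hΓ : Gamma σ ≠ 0 := Gamma_ne_zero_of_re_pos hσ
  rw [show Gamma γ * Gamma (α - γ + σ) / Gamma (α + σ)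
    = Gamma γ * Gamma (α - γ + σ) * Gamma σ / (Gamma σ * Gamma (α + σ)) by field_simp, ← h]
  refine setIntegral_congr_fun measurableSet_Ioi fun v hv => ?_
  have hv' : 0 < v := hv
  rw [hyp_neg α γ hγ hv'.le, sub_self, ordinaryHypergeometric_zero_right, mul_one]

/-! ### Beta integrals, scaling, and Fubini's theorem -/

/-- Euler's beta integral over the half-line. -/
theorem integral_beta_Ioi {l σ : ℂ} (hl : 0 < l.re) (hlσ : l.re < σ.re) :
    IntegrableOn (fun x : ℝ => (x : ℂ) ^ (l - 1) * ((1 + x : ℝ) : ℂ) ^ (-σ)) (Ioi 0) ∧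
      ∫ x : ℝ in Ioi 0, (x : ℂ) ^ (l - 1) * ((1 + x : ℝ) : ℂ) ^ (-σ)
        = Gamma l * Gamma (σ - l) / Gamma σ := by
  obtain ⟨hi, hs⟩ := hasSum_integral_hyp (α := 0) (β := 0) (γ := 1) (l := l) (σ := σ) (by simp) hl
    (by simpa using hlσ) (by simpa using hlσ)
  have hcongr : EqOn (fun x : ℝ => (x : ℂ) ^ (l - 1) * ((1 + x : ℝ) : ℂ) ^ (-σ) * hyp 0 0 1 (-x))
      (fun x : ℝ => (x : ℂ) ^ (l - 1) * ((1 + x : ℝ) : ℂ) ^ (-σ)) (Ioi 0) := fun x hx => by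
    simp only
    rw [hyp_neg 0 0 (by simp) (le_of_lt hx), ordinaryHypergeometric_symm,
      ordinaryHypergeometric_zero_right]
    simp
  refine ⟨hi.congr_fun hcongr measurableSet_Ioi, ?_⟩
  rw [← setIntegral_congr_fun measurableSet_Ioi hcongr]
  refine hs.unique (hasSum_of_eq (hasSum_single 0 fun n hn => ?_) (fun n => rfl) ?_)
  · simp [hypCoeff, Nat.pos_of_ne_zero hn]
  · simp [hypCoeff_zero]

/-- The scaled beta integral `∫ x ^ (l - 1) (x + z) ^ (-σ) dx`. -/
theorem integral_beta_Ioi_scaled {l σ : ℂ} (hl : 0 < l.re) (hlσ : l.re < σ.re) {z : ℝ}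
    (hz : 0 < z) :
    ∫ x : ℝ in Ioi 0, (x : ℂ) ^ (l - 1) * ((x : ℂ) + z) ^ (-σ)
      = (z : ℂ) ^ (l - σ) * (Gamma l * Gamma (σ - l) / Gamma σ) := by
  have hzne : (z : ℂ) ≠ 0 := by exact_mod_cast hz.ne'
  have h := integral_comp_mul_left_Ioi
    (fun x : ℝ => (x : ℂ) ^ (l - 1) * ((x : ℂ) + z) ^ (-σ)) 0 hz
  rw [mul_zero] at h
  rw [← (integral_beta_Ioi hl hlσ).2, ← integral_const_mul]
  have h2 : ∫ x : ℝ in Ioi 0, (x : ℂ) ^ (l - 1) * ((x : ℂ) + z) ^ (-σ) = (z : ℂ) *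
      ∫ x : ℝ in Ioi 0, ((z * x : ℝ) : ℂ) ^ (l - 1) * (((z * x : ℝ) : ℂ) + z) ^ (-σ) := by
    rw [h, real_smul, ofReal_inv, mul_inv_cancel_left₀ hzne]
  rw [h2, ← integral_const_mul]
  refine setIntegral_congr_fun measurableSet_Ioi fun x hx => ?_
  have hx' : 0 < x := hx
  rw [show ((z * x : ℝ) : ℂ) + z = (z : ℂ) * ((1 + x : ℝ) : ℂ) by push_cast; ring, ofReal_mul,
    mul_cpow_ofReal_nonneg hz.le hx'.le, mul_cpow_ofReal_nonneg hz.le (by linarith),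
    show l - σ = 1 + (l - 1) + -σ by ring, cpow_add _ _ hzne, cpow_add _ _ hzne, cpow_one]
  ring

/-- The generalized Stieltjes transform of `x ^ (γ - 1) ₂F₁(α, β; γ; -x / y)`. -/
theorem integral_hyp_stieltjes_scaled {α β γ σ : ℂ} (hγ : 0 < γ.re) (hα : 0 < α.re)
    (hσ : 0 < σ.re) (h1 : 0 < (α - γ + σ).re) (h2 : 0 < (β - γ + σ).re)
    (h3 : 0 < (α + β - γ + σ).re) {y z : ℝ} (hy : 0 < y) (hz : 0 < z) :
    IntegrableOn (fun x : ℝ => (x : ℂ) ^ (γ - 1) * hyp α β γ (-(x / y)) * ((x : ℂ) + z) ^ (-σ))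
        (Ioi 0) ∧
      ∫ x : ℝ in Ioi 0, (x : ℂ) ^ (γ - 1) * hyp α β γ (-(x / y)) * ((x : ℂ) + z) ^ (-σ)
        = Gamma γ * Gamma (α - γ + σ) * Gamma (β - γ + σ) / (Gamma σ * Gamma (α + β - γ + σ))
          * ((z : ℂ) ^ (γ - σ) * hyp β α (α + β - γ + σ) (1 - z / y)) := by
  have hyne : (y : ℂ) ≠ 0 := by exact_mod_cast hy.ne'
  have hzy : 0 < z / y := by positivity
  obtain ⟨hi, hv⟩ := integral_hyp_stieltjes hγ hα hσ h1 h2 h3 hzy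
  set g : ℝ → ℂ := fun x => (x : ℂ) ^ (γ - 1) * hyp α β γ (-(x / y)) * ((x : ℂ) + z) ^ (-σ) with hg
  have hcongr : EqOn (fun x : ℝ => g (y * x)) (fun x : ℝ => (y : ℂ) ^ (γ - 1 - σ) *
      ((x : ℂ) ^ (γ - 1) * hyp α β γ (-x) * ((x : ℂ) + ((z / y : ℝ) : ℂ)) ^ (-σ))) (Ioi 0) := by
    intro x hx
    have hx' : 0 < x := hx
    simp only [hg]
    rw [mul_div_cancel_left₀ _ hy.ne',
      show ((y * x : ℝ) : ℂ) + z = (y : ℂ) * ((x + z / y : ℝ) : ℂ) by push_cast; field_simp,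
      ofReal_mul, mul_cpow_ofReal_nonneg hy.le hx'.le,
      mul_cpow_ofReal_nonneg hy.le (by positivity), sub_eq_add_neg (γ - 1) σ, cpow_add _ _ hyne,
      ofReal_add]
    ring
  refine ⟨?_, ?_⟩
  · have h := (integrableOn_Ioi_comp_mul_left_iff g 0 hy).mp (by
      rw [integrableOn_congr_fun hcongr measurableSet_Ioi]
      exact hi.const_mul _)
    rwa [mul_zero] at h
  · have h := integral_comp_mul_left_Ioi g 0 hy
    rw [mul_zero, setIntegral_congr_fun measurableSet_Ioi hcongr, integral_const_mul, hv,
      real_smul, ofReal_inv, eq_inv_mul_iff_mul_eq₀ hyne] at h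
    have hdiv : ((z / y : ℝ) : ℂ) ^ (γ - σ) = (z : ℂ) ^ (γ - σ) / (y : ℂ) ^ (γ - σ) := by
      rw [div_eq_mul_inv, ofReal_mul, mul_cpow_ofReal_nonneg hz.le (by positivity), ofReal_inv,
        inv_cpow _ _ (by rw [arg_ofReal_of_nonneg hy.le]; exact Real.pi_ne_zero.symm),
        div_eq_mul_inv]
    rw [← h, hyp_one_sub_euler _ _ h3 hzy, show α + β - γ + σ - (α - γ + σ) = β by ring,
      show α + β - γ + σ - (β - γ + σ) = α by ring, show β - (β - γ + σ) = γ - σ by ring,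
      hdiv, show γ - 1 - σ = (γ - σ) - 1 by ring, cpow_sub _ _ hyne, cpow_one]
    have : (y : ℂ) ^ (γ - σ) ≠ 0 := by simp [cpow_eq_zero_iff, hyne]
    generalize (y : ℂ) ^ (γ - σ) = t at *
    field_simp

/-- The kernel of the Euler integral splits off a decaying factor in each variable. -/
lemma norm_kernel_le {σ : ℂ} {θ : ℝ} (hθ : 0 ≤ θ) (hθσ : θ ≤ σ.re) {y : ℝ} (hy : 0 < y)
    {x v : ℝ} (hx : 0 < x) (hv : 0 < v) :
    ‖((v : ℂ) + (((1 + x) / y : ℝ) : ℂ)) ^ (-σ)‖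
      ≤ (min 1 y⁻¹) ^ (-σ.re) * ((1 + x) ^ (-θ) * (1 + v) ^ (-(σ.re - θ))) := by
  have hpos : 0 < v + (1 + x) / y := by positivity
  have hm : 0 < min 1 y⁻¹ := lt_min one_pos (by positivity)
  have hlow : min 1 y⁻¹ * (v + 1 + x) ≤ v + (1 + x) / y := by
    have h1 : min 1 y⁻¹ * v ≤ 1 * v := by gcongr; exact min_le_left _ _
    have h2 : min 1 y⁻¹ * (1 + x) ≤ y⁻¹ * (1 + x) := by gcongr; exact min_le_right _ _
    rw [div_eq_inv_mul]
    linarith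
  rw [← ofReal_add, norm_cpow_eq_rpow_re_of_pos hpos, neg_re]
  calc (v + (1 + x) / y) ^ (-σ.re) ≤ (min 1 y⁻¹ * (v + 1 + x)) ^ (-σ.re) :=
        Real.rpow_le_rpow_of_nonpos (by positivity) hlow (by linarith)
    _ = (min 1 y⁻¹) ^ (-σ.re) * ((v + 1 + x) ^ (-θ) * (v + 1 + x) ^ (-(σ.re - θ))) := by
        rw [Real.mul_rpow hm.le (by positivity), ← Real.rpow_add (by positivity)]
        congr 2
        ring
    _ ≤ _ := by
        gcongr ?_ * (?_ * ?_)
        · exact Real.rpow_le_rpow_of_nonpos (by positivity) (by linarith) (by linarith)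
        · exact Real.rpow_le_rpow_of_nonpos (by positivity) (by linarith) (by linarith)

/-- Integration against a hypergeometric function that has an Euler integral: Fubini's theorem
replaces it by a generalized Stieltjes transform followed by one further integration. -/
theorem integral_mul_hyp_eq {f : ℝ → ℂ} {α γ σ : ℂ} (hγ : 0 < γ.re) (hα : 0 < α.re)
    (hσ : 0 < σ.re) {θ : ℝ} (hθ : 0 ≤ θ) (hθσ : θ ≤ σ.re) (hθ1 : θ < (α - γ + σ).re)
    (hf : IntegrableOn (fun x : ℝ => f x * ((1 + x : ℝ) : ℂ) ^ (-(θ : ℂ))) (Ioi 0))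
    {y : ℝ} (hy : 0 < y) :
    IntegrableOn (fun x : ℝ => f x * hyp (α - γ + σ) σ (α + σ) (1 - (1 + x) / y)) (Ioi 0) ∧
      ∫ x : ℝ in Ioi 0, f x * hyp (α - γ + σ) σ (α + σ) (1 - (1 + x) / y)
        = Gamma (α + σ) / (Gamma γ * Gamma (α - γ + σ)) *
          ∫ v : ℝ in Ioi 0, (v : ℂ) ^ (γ - 1) * ((1 + v : ℝ) : ℂ) ^ (-α) *
            ∫ x : ℝ in Ioi 0, f x * ((v : ℂ) + (((1 + x) / y : ℝ) : ℂ)) ^ (-σ) := by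
  have h1 : 0 < (α - γ + σ).re := hθ.trans_lt hθ1
  set μ : Measure ℝ := volume.restrict (Ioi 0) with hμ
  set G : ℝ → ℝ → ℂ := fun x v => f x * ((v : ℂ) ^ (γ - 1) * ((1 + v : ℝ) : ℂ) ^ (-α) *
    ((v : ℂ) + (((1 + x) / y : ℝ) : ℂ)) ^ (-σ)) with hG
  have hfm : AEStronglyMeasurable f μ := aestronglyMeasurable_of_mul_one_add_cpow hf
  have hker : IntegrableOn (fun v : ℝ => (v : ℂ) ^ (γ - 1) *
      ((1 + v : ℝ) : ℂ) ^ (-(α + σ - θ))) (Ioi 0) :=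
    (integral_beta_Ioi hγ (by simp at hθ1 ⊢; linarith)).1
  have hGi : Integrable (Function.uncurry G) (μ.prod μ) := by
    have hmaj := (Integrable.mul_prod hf.norm hker.norm).const_mul ((min 1 y⁻¹) ^ (-σ.re))
    refine hmaj.mono' ?_ ?_
    · refine (hfm.comp_fst).mul (Measurable.aestronglyMeasurable ?_)
      fun_prop
    · rw [Measure.prod_restrict]
      refine (ae_restrict_iff' (measurableSet_Ioi.prod measurableSet_Ioi)).mpr
        (ae_of_all _ fun xv hxv => ?_)
      obtain ⟨x, v⟩ := xv
      have hx : 0 < x := hxv.1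
      have hv : 0 < v := hxv.2
      have hx1 : 0 < 1 + x := by linarith
      have hv1 : 0 < 1 + v := by linarith
      have hk := norm_kernel_le hθ hθσ hy hx hv
      simp only [Function.uncurry, hG, norm_mul, norm_cpow_eq_rpow_re_of_pos hx1,
        norm_cpow_eq_rpow_re_of_pos hv1, norm_cpow_eq_rpow_re_of_pos hv]
      have e : (1 + v) ^ (-(α + σ - θ)).re = (1 + v) ^ (-α).re * (1 + v) ^ (-(σ.re - θ)) := by
        rw [← Real.rpow_add hv1]
        congr 1
        simp
        ring
      rw [e, show (-(θ : ℂ)).re = -θ by simp]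
      calc _ ≤ ‖f x‖ * (v ^ (γ - 1).re * (1 + v) ^ (-α).re * ((min 1 y⁻¹) ^ (-σ.re) *
            ((1 + x) ^ (-θ) * (1 + v) ^ (-(σ.re - θ))))) := by gcongr
        _ = _ := by ring
  have hinner : ∀ x ∈ Ioi (0 : ℝ), ∫ v, G x v ∂μ = Gamma γ * Gamma (α - γ + σ) / Gamma (α + σ) *
      (f x * hyp (α - γ + σ) σ (α + σ) (1 - (1 + x) / y)) := by
    intro x hx
    have hx' : 0 < x := hx
    simp only [hG]
    rw [integral_const_mul, hμ, integral_euler hγ hα hσ h1 (by positivity)]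
    ring
  have hΓ1 : Gamma γ ≠ 0 := Gamma_ne_zero_of_re_pos hγ
  have hΓ2 : Gamma (α - γ + σ) ≠ 0 := Gamma_ne_zero_of_re_pos h1
  have hΓ3 : Gamma (α + σ) ≠ 0 := Gamma_ne_zero_of_re_pos (by simp; linarith)
  have hcongr : EqOn (fun x : ℝ => Gamma (α + σ) / (Gamma γ * Gamma (α - γ + σ)) * ∫ v, G x v ∂μ)
      (fun x : ℝ => f x * hyp (α - γ + σ) σ (α + σ) (1 - (1 + x) / y)) (Ioi 0) := by
    intro x hx
    simp only
    rw [hinner x hx]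
    field_simp
  refine ⟨IntegrableOn.congr_fun (Integrable.const_mul hGi.integral_prod_left _) hcongr
    measurableSet_Ioi, ?_⟩
  rw [← setIntegral_congr_fun measurableSet_Ioi hcongr, integral_const_mul, ← hμ,
    integral_integral_swap hGi]
  congr 2
  ext v
  rw [← integral_const_mul]
  congr 1
  ext x
  simp only [hG]
  ring

/-! ### Values of the index transform -/

lemma ofReal_weight (a b : ℝ) {x : ℝ} (hx : 0 < x) :
    ((x ^ (a + b - 1) * (1 + x) ^ (a - b) : ℝ) : ℂ)
      = (x : ℂ) ^ ((a : ℂ) + b - 1) * ((1 + x : ℝ) : ℂ) ^ ((a : ℂ) - b) := by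
  rw [ofReal_mul, ofReal_cpow hx.le, ofReal_cpow (by linarith : (0 : ℝ) ≤ 1 + x)]
  push_cast
  rfl

/-- To compute a transform, rewrite the integrand on `(0, ∞)` and evaluate the integral. -/
lemma sends_of_integral {a b : ℝ} (hab : 0 < a + b) {f g : ℝ → ℂ}
    (h : ∀ s : ℝ, ∃ G : ℝ → ℂ, EqOn (integrand a b f s) G (Ioi 0) ∧ IntegrableOn G (Ioi 0) ∧
      ∫ x in Ioi (0 : ℝ), G x = Gamma (a + b) * g s) : Sends a b f g := by
  intro s
  obtain ⟨G, hG, hi, hv⟩ := h s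
  have hΓ : Gamma ((a : ℂ) + b) ≠ 0 := Gamma_ne_zero_of_re_pos (by simpa using hab)
  refine ⟨hi.congr_fun hG.symm measurableSet_Ioi, ?_⟩
  rw [J, setIntegral_congr_fun measurableSet_Ioi hG, hv]
  field_simp

theorem sends_one_add_cpow {a b : ℝ} (ha : 0 < a) (hb : 0 < b) {c : ℂ} (hc : 0 < c.re) :
    Sends a b (fun x => ((1 + x : ℝ) : ℂ) ^ (-a - c))
      (fun s => Gamma (c + I * s) * Gamma (c - I * s) / (Gamma (c + a) * Gamma (c + b))) := by
  refine sends_of_integral (by linarith) fun s => ?_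
  obtain ⟨hi, hv⟩ := integral_hyp_mul_one_add (α := a + I * s) (β := a - I * s) (γ := a + b)
    (σ := c + b) (by simp; linarith) (by simpa using ha) (by simp; linarith) (by simpa using hc)
    (by simpa using hc)
  refine ⟨_, fun x hx => ?_, hi, ?_⟩
  · have hx' : 0 < x := hx
    have hne : ((1 + x : ℝ) : ℂ) ≠ 0 := by exact_mod_cast (by linarith : 1 + x ≠ 0)
    simp only [integrand]
    rw [ofReal_weight a b hx', show -(c + b) = (-a - c) + ((a : ℂ) - b) by ring, cpow_add _ _ hne]
    ring
  · rw [hv, show (a + I * s) - (a + b) + (c + b) = c + I * s by ring,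
      show (a - I * s) - (a + b) + (c + b) = c - I * s by ring,
      show (a + I * s) + (a - I * s) - (a + b) + (c + b) = c + a by ring]
    ring

theorem sends_add_cpow {a b : ℝ} (ha : 0 < a) (hb : 0 < b) {c : ℂ} (hc : 0 < c.re) {z : ℝ}
    (hz : 0 < z) :
    Sends a b (fun x => ((1 + x : ℝ) : ℂ) ^ ((b : ℂ) - a) / ((x + z : ℝ) : ℂ) ^ (c + b))
      (fun s => gammaQuot [c + I * s, c - I * s] [c + a, c + b]
        * hyp (c + I * s) (c - I * s) (c + a) (1 - z)) := by
  refine sends_of_integral (by linarith) fun s => ?_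
  obtain ⟨hi, hv⟩ := integral_hyp_stieltjes (α := a + I * s) (β := a - I * s) (γ := a + b)
    (σ := c + b) (by simp; linarith) (by simpa using ha) (by simp; linarith) (by simpa using hc)
    (by simpa using hc) (by simp; linarith) hz
  refine ⟨_, fun x hx => ?_, hi, ?_⟩
  · have hx' : 0 < x := hx
    have hne : ((1 + x : ℝ) : ℂ) ≠ 0 := by exact_mod_cast (by linarith : 1 + x ≠ 0)
    have h1 : ((1 + x : ℝ) : ℂ) ^ ((b : ℂ) - a) * ((1 + x : ℝ) : ℂ) ^ ((a : ℂ) - b) = 1 := by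
      rw [← cpow_add _ _ hne]
      simp
    simp only [integrand]
    rw [ofReal_weight a b hx', ofReal_add x z, cpow_neg, div_eq_mul_inv]
    linear_combination ((x : ℂ) ^ ((a : ℂ) + b - 1) * hyp (a + I * s) (a - I * s) (a + b) (-x) *
      (((x : ℂ) + z) ^ (c + b))⁻¹) * h1
  · rw [hv, show (a + I * s) - (a + b) + (c + b) = c + I * s by ring,
      show (a - I * s) - (a + b) + (c + b) = c - I * s by ring,
      show (a + I * s) + (a - I * s) - (a + b) + (c + b) = c + a by ring]
    simp only [gammaQuot, List.map_cons, List.map_nil, List.prod_cons, List.prod_nil]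
    ring

theorem sends_cpow {a b : ℝ} (ha : 0 < a) {u : ℂ} (hu : 0 < u.re) (hub : u.re < b) :
    Sends a b (fun x => (x : ℂ) ^ (-u - a))
      (fun s => Gamma (-u + b) / Gamma (a + u)
        * (Gamma (u + I * s) * Gamma (u - I * s) / (Gamma (b + I * s) * Gamma (b - I * s)))) := by
  refine sends_of_integral (by linarith) fun s => ?_
  obtain ⟨hi, hv⟩ := integral_hyp_mul_power (α := a + I * s) (β := a - I * s) (γ := a + b)
    (l := -u + b) (by simp; linarith) (by simp; linarith) (by simp; linarith)
    (by simp; linarith) (by simp; linarith)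
  refine ⟨_, fun x hx => ?_, hi, ?_⟩
  · have hx' : 0 < x := hx
    have hne : (x : ℂ) ≠ 0 := by exact_mod_cast hx'.ne'
    simp only [integrand]
    rw [ofReal_weight a b hx', show -u + b - 1 = (-u - a) + ((a : ℂ) + b - 1) by ring,
      cpow_add _ _ hne, show -((a : ℂ) + b - (a + I * s) - (a - I * s)) = a - b by ring]
    ring
  · rw [hv, show (a : ℂ) + b - (a + I * s) - (-u + b) = u - I * s by ring,
      show (a : ℂ) + b - (a - I * s) - (-u + b) = u + I * s by ring,
      show (a : ℂ) + b - (a + I * s) = b - I * s by ring,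
      show (a : ℂ) + b - (a - I * s) = b + I * s by ring,
      show (a : ℂ) + b - (-u + b) = a + u by ring]
    ring

/-- A Mellin transform of `v ↦ ₂F₁(A, B; C; 1 - (1 + v) / y)`. Inserting the Euler integral of the
hypergeometric function leaves a beta integral in `v`. -/
theorem integral_power_mul_hyp_one_sub {A B C l : ℂ} (hl : 0 < l.re) (hlA : l.re < A.re)
    (hlB : l.re < B.re) (hA : A.re < C.re) (hB : B.re < C.re) {y : ℝ} (hy : 0 < y) :
    ∫ v : ℝ in Ioi 0, (v : ℂ) ^ (l - 1) * hyp A B C (1 - (1 + v) / y)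
      = (y : ℂ) ^ l * (Gamma l * Gamma (A - l) * Gamma (B - l) * Gamma C /
        (Gamma A * Gamma B * Gamma (C - l))) * hyp (A - l) (B - l) (C - l) (1 - y⁻¹) := by
  have hyne : (y : ℂ) ≠ 0 := by exact_mod_cast hy.ne'
  have hyi : 0 < y⁻¹ := by positivity
  obtain ⟨θ, hθ1, hθ2⟩ := exists_between (lt_min hlA hlB)
  obtain ⟨hθA, hθB⟩ := lt_min_iff.mp hθ2
  have hv := (integral_mul_hyp_eq (f := fun v : ℝ => (v : ℂ) ^ (l - 1)) (α := C - B)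
    (γ := C - A) (σ := B) (θ := θ) (by simpa using hA) (by simpa using hB) (by linarith)
    (by linarith) (by linarith) (by simpa using hθA)
    (integral_beta_Ioi hl (by simpa using hθ1)).1 hy).2
  rw [show C - B - (C - A) + B = A by ring, sub_add_cancel] at hv
  have hstep : ∀ t ∈ Ioi (0 : ℝ), (t : ℂ) ^ (C - A - 1) * ((1 + t : ℝ) : ℂ) ^ (-(C - B)) *
      ∫ v : ℝ in Ioi 0, (v : ℂ) ^ (l - 1) * ((t : ℂ) + (((1 + v) / y : ℝ) : ℂ)) ^ (-B)
      = (y : ℂ) ^ l * (Gamma l * Gamma (B - l) / Gamma B) *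
        ((t : ℂ) ^ (C - A - 1) * ((1 + t : ℝ) : ℂ) ^ (-(C - B)) *
          ((t : ℂ) + ((y⁻¹ : ℝ) : ℂ)) ^ (-(B - l))) := by
    intro t ht
    have ht' : 0 < t := ht
    have hpos : 0 < t + y⁻¹ := by positivity
    have hcongr : EqOn (fun v : ℝ => (v : ℂ) ^ (l - 1) *
        ((t : ℂ) + (((1 + v) / y : ℝ) : ℂ)) ^ (-B))
        (fun v : ℝ => (y : ℂ) ^ B * ((v : ℂ) ^ (l - 1) *
          ((v : ℂ) + ((y * (t + y⁻¹) : ℝ) : ℂ)) ^ (-B))) (Ioi 0) := by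
      intro v hv
      have hv' : 0 < v := hv
      have h1 : (y : ℂ) ^ B * (y : ℂ) ^ (-B) = 1 := by
        rw [← cpow_add _ _ hyne, add_neg_cancel, cpow_zero]
      simp only
      rw [← ofReal_add, ← ofReal_add,
        show v + y * (t + y⁻¹) = y * (t + (1 + v) / y) by field_simp; ring, ofReal_mul,
        mul_cpow_ofReal_nonneg hy.le (by positivity)]
      linear_combination (-(v : ℂ) ^ (l - 1) * ((t + (1 + v) / y : ℝ) : ℂ) ^ (-B)) * h1
    rw [setIntegral_congr_fun measurableSet_Ioi hcongr, integral_const_mul,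
      integral_beta_Ioi_scaled hl hlB (by positivity), show l - B = -(B - l) by ring,
      ofReal_mul, mul_cpow_ofReal_nonneg hy.le hpos.le, ofReal_add t,
      show (y : ℂ) ^ l = (y : ℂ) ^ B * (y : ℂ) ^ (-(B - l)) by
        rw [← cpow_add _ _ hyne]; congr 1; ring]
    ring
  rw [hv, setIntegral_congr_fun measurableSet_Ioi hstep, integral_const_mul,
    integral_euler (by simpa using hA) (by simpa using hB) (by simpa using hlB)
      (by simp; linarith) hyi,
    show C - B - (C - A) + (B - l) = A - l by ring, show C - B + (B - l) = C - l by ring]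
  have hΓ : Gamma (C - A) ≠ 0 := Gamma_ne_zero_of_re_pos (by simpa using hA)
  field_simp

/-- The Stieltjes transform that arises when the Euler integral of `₂F₁(a + w, a - w; a + b; -x)` is
inserted. In the form given by Euler's transformation, its power of `1 + v` cancels against the
weight of the Euler integral. -/
lemma weight_mul_stieltjes {a b : ℝ} (ha : 0 < a) (hb : 0 < b) {p q w : ℂ} (hp : 0 < p.re)
    (hq : 0 < q.re) (hw : w.re = 0) {y : ℝ} (hy : 0 < y) {v : ℝ} (hv : 0 < v) :
    (v : ℂ) ^ ((b : ℂ) - w - 1) * ((1 + v : ℝ) : ℂ) ^ (-((b : ℂ) + w)) *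
        ∫ x : ℝ in Ioi 0, (x : ℂ) ^ ((a : ℂ) + b - 1) * hyp (p + b) (q + b) (a + b) (-(x / y)) *
          ((v : ℂ) + ((1 + x : ℝ) : ℂ)) ^ (-((a : ℂ) - w))
      = Gamma (a + b) * Gamma (p - w) * Gamma (q - w) / (Gamma (a - w) * Gamma (p + q + b - w)) *
        ((v : ℂ) ^ ((b : ℂ) - w - 1) *
          hyp (q + b) (p + b) (p + q + b - w) (1 - (1 + v) / y)) := by
  have hv' : 0 < 1 + v := by linarith
  have hne : ((1 + v : ℝ) : ℂ) ≠ 0 := by exact_mod_cast hv'.ne'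
  have h := (integral_hyp_stieltjes_scaled (α := p + b) (β := q + b) (γ := a + b) (σ := a - w)
    (by simp; linarith) (by simp; linarith) (by simp [hw, ha]) (by simp [hw, hp])
    (by simp [hw, hq]) (by simp [hw]; linarith) hy hv').2
  rw [show p + b - (a + b) + (a - w) = p - w by ring,
    show q + b - (a + b) + (a - w) = q - w by ring,
    show p + b + (q + b) - (a + b) + (a - w) = p + q + b - w by ring,
    show (a : ℂ) + b - (a - w) = b + w by ring] at h
  have h1 : ((1 + v : ℝ) : ℂ) ^ (-((b : ℂ) + w)) * ((1 + v : ℝ) : ℂ) ^ ((b : ℂ) + w) = 1 := by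
    rw [← cpow_add _ _ hne, neg_add_cancel, cpow_zero]
  have hswap : ∀ x : ℝ, (v : ℂ) + ((1 + x : ℝ) : ℂ) = (x : ℂ) + ((1 + v : ℝ) : ℂ) := fun x => by
    push_cast
    ring
  simp only [hswap]
  rw [h]
  linear_combination (Gamma (a + b) * Gamma (p - w) * Gamma (q - w) /
    (Gamma (a - w) * Gamma (p + q + b - w)) * (v : ℂ) ^ ((b : ℂ) - w - 1) *
    hyp (q + b) (p + b) (p + q + b - w) (1 - (1 + v) / y)) * h1

/-- The integral of a product of two hypergeometric functions with the same third parameter. Only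
`₂F₁(a + w, a - w; a + b; -x)` is replaced by an Euler integral: the other factor need not have one,
as the real parts of `p` and `q` may exceed `a`. -/
theorem integral_hyp_mul_hyp {a b : ℝ} (ha : 0 < a) (hb : 0 < b) {p q w : ℂ} (hp : 0 < p.re)
    (hq : 0 < q.re) (hw : w.re = 0) {y : ℝ} (hy : 0 < y) :
    IntegrableOn (fun x : ℝ => (x : ℂ) ^ ((a : ℂ) + b - 1) *
        hyp (p + b) (q + b) (a + b) (-(x / y)) * hyp (a + w) (a - w) (a + b) (-x)) (Ioi 0) ∧
      ∫ x : ℝ in Ioi 0, (x : ℂ) ^ ((a : ℂ) + b - 1) *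
          hyp (p + b) (q + b) (a + b) (-(x / y)) * hyp (a + w) (a - w) (a + b) (-x)
        = (y : ℂ) ^ ((b : ℂ) + p) * (Gamma (a + b) ^ 2 *
          (Gamma (p + w) * Gamma (p - w) * Gamma (q + w) * Gamma (q - w)) /
          (Gamma (p + q) * Gamma (p + b) * Gamma (q + b) * (Gamma (a + w) * Gamma (a - w)))) *
          hyp (p + w) (p - w) (p + q) (1 - y) := by
  have hyne : (y : ℂ) ≠ 0 := by exact_mod_cast hy.ne'
  have hyi : 0 < y⁻¹ := by positivity
  -- the part of the decay in `x` that is taken from the kernel of the Euler integral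
  obtain ⟨θ, hθ1, hθ2⟩ := exists_between
    (max_lt ha (max_lt (sub_lt_self a hp) (sub_lt_self a hq)))
  simp only [max_lt_iff] at hθ1
  obtain ⟨hθ0, hθp, hθq⟩ := hθ1
  have hfi : IntegrableOn (fun x : ℝ => (x : ℂ) ^ ((a : ℂ) + b - 1) *
      hyp (p + b) (q + b) (a + b) (-(x / y)) * ((1 + x : ℝ) : ℂ) ^ (-(θ : ℂ))) (Ioi 0) := by
    have h := (integral_hyp_stieltjes_scaled (α := p + b) (β := q + b) (γ := a + b) (σ := θ)
      (by simp; linarith) (by simp; linarith) (by simpa using hθ0) (by simp; linarith)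
      (by simp; linarith) (by simp; linarith) hy one_pos).1
    refine h.congr_fun (fun x _ => ?_) measurableSet_Ioi
    simp only
    rw [← ofReal_add x, add_comm x]
  have key := integral_mul_hyp_eq (α := b + w) (γ := b - w) (σ := a - w)
    (by simp [hw, hb]) (by simp [hw, hb]) (by simp [hw, ha]) hθ0.le
    (by simp [hw, hθ2.le]) (by simp [hw, hθ2]) hfi one_pos
  rw [show (b : ℂ) + w - (b - w) + (a - w) = a + w by ring,
    show (b : ℂ) + w + (a - w) = a + b by ring] at key
  simp only [div_one, sub_add_cancel_left] at key
  refine ⟨key.1, ?_⟩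
  rw [key.2, setIntegral_congr_fun measurableSet_Ioi
    (fun v hv => weight_mul_stieltjes ha hb hp hq hw hy hv), integral_const_mul,
    integral_power_mul_hyp_one_sub (by simp [hw, hb]) (by simp [hw, hq]) (by simp [hw, hp])
      (by simp [hw]; linarith) (by simp [hw]; linarith) hy,
    show q + b - (b - w) = q + w by ring, show p + b - (b - w) = p + w by ring,
    show p + q + b - w - (b - w) = p + q by ring,
    hyp_one_sub_pfaff (p + w) (p - w) (by simp; linarith) hy,
    show p + q - (p - w) = q + w by ring, hyp_symm (p + w) (q + w) (by simp; linarith) hyi,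
    show (y : ℂ) ^ ((b : ℂ) - w) = (y : ℂ) ^ ((b : ℂ) + p) * (y : ℂ) ^ (-(p + w)) by
      rw [← cpow_add _ _ hyne]; congr 1; ring]
  have hΓ1 : Gamma (b - w) ≠ 0 := Gamma_ne_zero_of_re_pos (by simp [hw, hb])
  have hΓ3 : Gamma (p + q + b - w) ≠ 0 := Gamma_ne_zero_of_re_pos (by simp [hw]; linarith)
  have hc : Gamma (b - w) * (Gamma (b - w))⁻¹ *
      (Gamma (p + q + b - w) * (Gamma (p + q + b - w))⁻¹) = 1 := by
    rw [mul_inv_cancel₀ hΓ1, mul_inv_cancel₀ hΓ3, one_mul]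
  linear_combination ((y : ℂ) ^ ((b : ℂ) + p) * (Gamma (a + b) ^ 2 *
    (Gamma (p + w) * Gamma (p - w) * Gamma (q + w) * Gamma (q - w)) /
    (Gamma (p + q) * Gamma (p + b) * Gamma (q + b) * (Gamma (a + w) * Gamma (a - w)))) *
    ((y : ℂ) ^ (-(p + w)) * hyp (q + w) (p + w) (p + q) (1 - y⁻¹))) * hc

theorem sends_hyp_mul {a b : ℝ} (ha : 0 < a) (hb : 0 < b) {p q : ℂ} (hp : 0 < p.re)
    (hq : 0 < q.re) {y : ℝ} (hy : 0 < y) :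
    Sends a b
      (fun x => hyp (p + b) (q + b) (a + b) (-(x / y)) * ((1 + x : ℝ) : ℂ) ^ ((b : ℂ) - a))
      (fun s => (y : ℂ) ^ (b + p) * gammaQuot [a + b] [p + q, p + b, q + b]
        * gammaQuot [p + I * s, p - I * s, q + I * s, q - I * s] [a + I * s, a - I * s]
        * hyp (p + I * s) (p - I * s) (p + q) (1 - y)) := by
  refine sends_of_integral (by linarith) fun s => ?_
  obtain ⟨hi, hv⟩ := integral_hyp_mul_hyp ha hb hp hq (w := I * s) (by simp) hy
  refine ⟨_, fun x hx => ?_, hi, ?_⟩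
  · have hx' : 0 < x := hx
    have hne : ((1 + x : ℝ) : ℂ) ≠ 0 := by exact_mod_cast (by linarith : 1 + x ≠ 0)
    have h1 : ((1 + x : ℝ) : ℂ) ^ ((b : ℂ) - a) * ((1 + x : ℝ) : ℂ) ^ ((a : ℂ) - b) = 1 := by
      rw [← cpow_add _ _ hne]
      simp
    simp only [integrand]
    rw [ofReal_weight a b hx']
    linear_combination (hyp (p + b) (q + b) (a + b) (-(x / y)) *
      hyp (a + I * s) (a - I * s) (a + b) (-x) * (x : ℂ) ^ ((a : ℂ) + b - 1)) * h1
  · rw [hv]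
    simp only [gammaQuot, List.map_cons, List.map_nil, List.prod_cons, List.prod_nil, mul_one]
    ring

theorem sends_hyp_mul_one {a b : ℝ} (ha : 0 < a) (hb : 0 < b) {p q : ℂ} (hp : 0 < p.re)
    (hq : 0 < q.re) :
    Sends a b
      (fun x => hyp (p + b) (q + b) (a + b) (-x) * ((1 + x : ℝ) : ℂ) ^ ((b : ℂ) - a))
      (fun s => gammaQuot [a + b] [p + q, p + b, q + b]
        * gammaQuot [p + I * s, p - I * s, q + I * s, q - I * s] [a + I * s, a - I * s]) := by
  have h := sends_hyp_mul ha hb hp hq one_pos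
  simpa [hyp_zero] using h

/-- After Euler's transformation the factor `(1 + x) ^ (b - a)` cancels and `f` has an Euler
integral with kernel `(1 + x + v) ^ (-b - c)`. Its Stieltjes transform is hypergeometric in `-v`, so
that the integral over `v` is of the same type as in `integral_hyp_mul_one_add`. -/
theorem sends_hyp {a b : ℝ} (ha : 0 < a) (hb : 0 < b) {c d : ℂ} (hc : 0 < c.re)
    (hd : 0 < d.re) :
    Sends a b (fun x => hyp (a + c) (a + d) (a + b + c + d) (-x))
      (fun s => Gamma (a + b + c + d)
        * (Gamma (c + I * s) * Gamma (c - I * s) * Gamma (d + I * s) * Gamma (d - I * s))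
        / (Gamma (a + c) * Gamma (a + d) * Gamma (b + c) * Gamma (b + d) * Gamma (c + d))) := by
  refine sends_of_integral (by linarith) fun s => ?_
  set w : ℂ := I * s with hw
  have hw0 : w.re = 0 := by simp [hw]
  set f : ℝ → ℂ := fun x => (x : ℂ) ^ ((a : ℂ) + b - 1) * hyp (a + w) (a - w) (a + b) (-x)
    with hf
  -- the kernel supplies a decay in `x` of any order below `b + min (Re c) (Re d)`, and an order
  -- above `b` makes the integral over `x` converge
  obtain ⟨θ, hθ1, hθ2⟩ := exists_between (lt_min (lt_add_of_pos_right b hc)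
    (lt_add_of_pos_right b hd))
  obtain ⟨hθc, hθd⟩ := lt_min_iff.mp hθ2
  have hfi : IntegrableOn (fun x : ℝ => f x * ((1 + x : ℝ) : ℂ) ^ (-(θ : ℂ))) (Ioi 0) := by
    have h := (integral_hyp_mul_one_add (α := a + w) (β := a - w) (γ := a + b) (σ := θ)
      (by simp; linarith) (by simp [hw0, ha]) (by simp; linarith) (by simp [hw0]; linarith)
      (by simp [hw0]; linarith)).1
    exact h.congr_fun (fun x _ => mul_right_comm _ _ _) measurableSet_Ioi
  obtain ⟨hi, hv⟩ := integral_mul_hyp_eq (f := f) (α := a + d) (γ := a + c) (σ := b + c)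
    (by simp; linarith) (by simp; linarith) (by simp; linarith) (by linarith)
    (by simp; linarith) (by simp; linarith) hfi one_pos
  have e1 : (a : ℂ) + d - (a + c) + (b + c) = b + d := by ring
  have e2 : (a : ℂ) + d + (b + c) = a + b + c + d := by ring
  rw [e1, e2] at hi hv
  simp only [div_one, sub_add_cancel_left] at hi hv
  have hr : 0 < ((a : ℂ) + b + c + d).re := by simp; linarith
  refine ⟨_, fun x hx => ?_, hi, ?_⟩
  · have hx' : 0 < 1 + x := by have : 0 < x := hx; linarith
    have hne : ((1 + x : ℝ) : ℂ) ≠ 0 := by exact_mod_cast hx'.ne'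
    have h1 : ((1 + x : ℝ) : ℂ) ^ ((b : ℂ) - a) * ((1 + x : ℝ) : ℂ) ^ ((a : ℂ) - b) = 1 := by
      rw [← cpow_add _ _ hne]
      simp
    have h2 := hyp_one_sub_euler (a + c) (a + d) hr hx'
    rw [show 1 - (1 + x) = -x by ring, show (a : ℂ) + b + c + d - (a + c) - (a + d) = b - a by ring,
      show (a : ℂ) + b + c + d - (a + c) = b + d by ring,
      show (a : ℂ) + b + c + d - (a + d) = b + c by ring] at h2
    simp only [integrand, hf]
    rw [ofReal_weight a b hx, h2]
    linear_combination (hyp (b + d) (b + c) (a + b + c + d) (-x) *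
      hyp (a + w) (a - w) (a + b) (-x) * (x : ℂ) ^ ((a : ℂ) + b - 1)) * h1
  have hstep : ∀ v ∈ Ioi (0 : ℝ),
      (v : ℂ) ^ ((a : ℂ) + c - 1) * ((1 + v : ℝ) : ℂ) ^ (-((a : ℂ) + d)) *
      ∫ x : ℝ in Ioi 0, f x * ((v : ℂ) + ((1 + x : ℝ) : ℂ)) ^ (-((b : ℂ) + c))
      = Gamma (a + b) * Gamma (c + w) * Gamma (c - w) / (Gamma (b + c) * Gamma (a + c)) *
        ((v : ℂ) ^ ((a : ℂ) + c - 1) * ((1 + v : ℝ) : ℂ) ^ (-((a : ℂ) + d)) *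
          hyp (c + w) (c - w) (a + c) (-v)) := by
    intro v hv
    have hv' : 0 < 1 + v := by have : 0 < v := hv; linarith
    have h := (integral_hyp_stieltjes (α := a + w) (β := a - w) (γ := a + b) (σ := b + c)
      (by simp; linarith) (by simp [hw0, ha]) (by simp; linarith) (by simp [hw0, hc])
      (by simp [hw0, hc]) (by simp; linarith) hv').2
    rw [show a + w - (a + b) + (b + c) = c + w by ring,
      show a - w - (a + b) + (b + c) = c - w by ring,
      show a + w + (a - w) - (a + b) + (b + c) = a + c by ring,
      show 1 - (1 + v) = -v by ring] at h
    have hcongr : ∫ x : ℝ in Ioi 0, f x * ((v : ℂ) + ((1 + x : ℝ) : ℂ)) ^ (-((b : ℂ) + c))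
        = ∫ x : ℝ in Ioi 0, (x : ℂ) ^ ((a : ℂ) + b - 1) * hyp (a + w) (a - w) (a + b) (-x) *
          ((x : ℂ) + ((1 + v : ℝ) : ℂ)) ^ (-((b : ℂ) + c)) := by
      congr 1
      ext x
      simp only [hf]
      congr 2
      push_cast
      ring
    rw [hcongr, h]
    ring
  rw [hv, setIntegral_congr_fun measurableSet_Ioi hstep, integral_const_mul,
    (integral_hyp_mul_one_add (α := c + w) (β := c - w) (γ := a + c) (σ := a + d)
      (by simp; linarith) (by simp [hw0, hc]) (by simp; linarith) (by simp [hw0, hd])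
      (by simp [hw0, hd])).2,
    show c + w - (a + c) + (a + d) = d + w by ring,
    show c - w - (a + c) + (a + d) = d - w by ring,
    show c + w + (c - w) - (a + c) + (a + d) = c + d by ring]
  have hΓ : Gamma (a + c) ≠ 0 := Gamma_ne_zero_of_re_pos (by simp; linarith)
  field_simp

end IndexTransform

open IndexTransform Complex in
theorem lemma2p2 (a b : ℝ) (ha : 0 < a) (hb : 0 < b) :
    (∀ c : ℂ, 0 < c.re →
      Sends a b (fun x => ((1 + x : ℝ) : ℂ) ^ (-a - c))
        (fun s => Gamma (c + I * s) * Gamma (c - I * s) / (Gamma (c + a) * Gamma (c + b)))) ∧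
    (∀ c : ℂ, 0 < c.re → ∀ z : ℝ, 0 < z →
      Sends a b (fun x => ((1 + x : ℝ) : ℂ) ^ ((b : ℂ) - a) / ((x + z : ℝ) : ℂ) ^ (c + b))
        (fun s => gammaQuot [c + I * s, c - I * s] [c + a, c + b]
          * hyp (c + I * s) (c - I * s) (c + a) (1 - z))) ∧
    (∀ u : ℂ, 0 < u.re → u.re < b →
      Sends a b (fun x => (x : ℂ) ^ (-u - a))
        (fun s => Gamma (-u + b) / Gamma (a + u)
          * (Gamma (u + I * s) * Gamma (u - I * s) / (Gamma (b + I * s) * Gamma (b - I * s))))) ∧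
    (∀ p q : ℂ, 0 < p.re → 0 < q.re → ∀ y : ℝ, 0 < y →
      Sends a b
        (fun x => hyp (p + b) (q + b) (a + b) (-(x / y)) * ((1 + x : ℝ) : ℂ) ^ ((b : ℂ) - a))
        (fun s => (y : ℂ) ^ (b + p) * gammaQuot [a + b] [p + q, p + b, q + b]
          * gammaQuot [p + I * s, p - I * s, q + I * s, q - I * s] [a + I * s, a - I * s]
          * hyp (p + I * s) (p - I * s) (p + q) (1 - y))) ∧
    (∀ p q : ℂ, 0 < p.re → 0 < q.re →
      Sends a b
        (fun x => hyp (p + b) (q + b) (a + b) (-x) * ((1 + x : ℝ) : ℂ) ^ ((b : ℂ) - a))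
        (fun s => gammaQuot [a + b] [p + q, p + b, q + b]
          * gammaQuot [p + I * s, p - I * s, q + I * s, q - I * s] [a + I * s, a - I * s])) ∧
    (∀ c d : ℂ, 0 < c.re → 0 < d.re →
      Sends a b (fun x => hyp (a + c) (a + d) (a + b + c + d) (-x))
        (fun s => Gamma (a + b + c + d)
          * (Gamma (c + I * s) * Gamma (c - I * s) * Gamma (d + I * s) * Gamma (d - I * s))
          / (Gamma (a + c) * Gamma (a + d) * Gamma (b + c) * Gamma (b + d) * Gamma (c + d)))) := by
  exact ⟨fun c hc => sends_one_add_cpow ha hb hc, fun c hc z hz => sends_add_cpow ha hb hc hz,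
    fun u hu hub => sends_cpow ha hu hub, fun p q hp hq y hy => sends_hyp_mul ha hb hp hq hy,
    fun p q hp hq => sends_hyp_mul_one ha hb hp hq, fun c d hc hd => sends_hyp ha hb hc hd⟩
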